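/- Let $K:\mathbb R^n\setminus\{0\}\to[0,\infty)$ satisfy $K(-x)=K(x)$ and $\min\{1,|x|\}K(x)\in L^1(\mathbb R^n)$. Assume moreover that for every $C>0$ $$\lim_{r\downarrow0}\ \sup_{|e|=1}\int_{\{|y|<r,\ |y\cdot e|\le C|y|^2\}}K(y)\,dy=0$$ (this holds for instance if $K$ is radial; given the previous assumptions, it is equivalent to saying that the $K$-curvature, defined next, of every ball is finite and continuous along its boundary). For a set $F$ with boundary of class $C^{1,1}$ and $x\in\partial F$ put $$H^K_F(x)=\lim_{\varepsilon\downarrow0}\int_{\mathbb R^n\setminus B(x,\varepsilon)}\big(\chi_{\mathbb R^n\setminus F}(y)-\chi_F(y)\big)K(x-y)\,dy .$$ For an arbitrary set $E$ and $x\in\partial E$, the inequality $H^K_E(x)\ge c$ holds in the viscosity sense if $H^K_F(x)\ge c$ for all sets $F\subseteq E$ with compact boundary of class $C^{1,1}$ and $x\in\partial F$. For $\lambda\ge0$ let $E^\lambda=\{x: d(x,E)\le\lambda\}$. A closed set $E$ is strongly $K$-mean convex with constant $\delta\ge0$ if there is $\xi>0$ such that, for all $\lambda\in[0,\xi]$,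 $H^K_{E^\lambda}\ge\delta$ on $\partial E^\lambda$ in the viscosity sense. For a measurable set $E$ and an open set $\Omega$ let $$\mathrm{Per}_K(E,\Omega)=\int_E\int_{\Omega\setminus E}K(x-y)\,dx\,dy+\int_{E\cap\Omega}\int_{\mathbb R^n\setminus(\Omega\cup E)}K(x-y)\,dx\,dy\in[0,\infty].$$ Write $A\subset\subset\Omega$ if $\overline A$ is compact and contained in $\Omega$. The set $E$ is $K$-outward minimizing in $\Omega$ if $\mathrm{Per}_K(E,\Omega)\le\mathrm{Per}_K(F,\Omega)$ for all measurable $F\supseteq E$ with $F\setminus E\subset\subset\Omega$, and strongly $K$-outward minimizing in $\Omega$ with constant $\delta>0$ if $\mathrm{Per}_K(E,\Omega)+\delta|F\setminus E|\le\mathrm{Per}_K(F,\Omega)$ for all such $F$. 1. Let $\Omega$ be open, let $E\subset\subset\Omega$ be measurable, and suppose that $|B(x,r)\setminus E|>0$ for all $x\in\partial E$ and $r>0$ (as is the case whenever $E$ is compact). If $E$ is $K$-outward minimizing in $\Omega$, then $H^K_E(x)\ge0$ in the viscosity sense for all $x\in\partial E$. If $E$ is strongly $K$-outward minimizing in $\Omega$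 with constant $\delta>0$, then $H^K_E(x)\ge\delta$ in the viscosity sense for all $x\in\partial E$. 2. Let $E\subset\mathbb R^n$ be a bounded set with boundary of class $C^{1,1}$ that is strongly $K$-mean convex with constant $\delta\ge0$. Then there is an open set $\Omega$ with $E\subset\subset\Omega$ such that $E$ is $K$-outward minimizing in $\Omega$ if $\delta=0$, and strongly $K$-outward minimizing in $\Omega$ with constant $\delta$ if $\delta>0$. -/

import Mathlib

open MeasureTheory Filter Topology Set
open scoped NNReal ENNReal

namespace KPer

/-- Standing assumptions on the interaction kernel `K : ℝⁿ ∖ {0} → [0, ∞)`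
(the value at the origin is irrelevant). -/
structure IsKernel {n : ℕ} (K : EuclideanSpace ℝ (Fin n) → ℝ) : Prop where
  nonneg : ∀ x, x ≠ 0 → 0 ≤ K x
  symm : ∀ x, K (-x) = K x
  integrable : Integrable (fun x => min 1 ‖x‖ * K x) volume

/-- The mass that `K` gives to `{y : |y| < r, |y · e| ≤ C |y|²}` (the region between two tangent
paraboloids orthogonal to `e`) tends to zero as `r → 0`, uniformly in the unit vector `e`. -/
def IsTangentiallyIntegrable {n : ℕ} (K : EuclideanSpace ℝ (Fin n) → ℝ) : Prop :=
  ∀ C : ℝ, 0 < C → ∀ ε : ℝ, 0 < ε → ∃ r : ℝ, 0 < r ∧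
    ∀ e : EuclideanSpace ℝ (Fin n), ‖e‖ = 1 →
      ∫⁻ y in {y | ‖y‖ < r ∧ |inner ℝ y e| ≤ C * ‖y‖ ^ 2}, ENNReal.ofReal (K y) ∂volume
        ≤ ENNReal.ofReal ε

/-- `F` has boundary of class `C^{1,1}`: near every boundary point `F` is, up to its boundary,
the superlevel set `{φ > 0}` of a function with Lipschitz, nowhere vanishing gradient. -/
def HasC11Boundary {n : ℕ} (F : Set (EuclideanSpace ℝ (Fin n))) : Prop :=
  ∀ x ∈ frontier F, ∃ r : ℝ, 0 < r ∧
    ∃ (φ : EuclideanSpace ℝ (Fin n) → ℝ)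
      (g : EuclideanSpace ℝ (Fin n) → EuclideanSpace ℝ (Fin n)) (L : ℝ≥0),
      (∀ y ∈ Metric.ball x r, HasGradientAt φ (g y) y) ∧
      LipschitzOnWith L g (Metric.ball x r) ∧
      (∀ y ∈ Metric.ball x r, g y ≠ 0) ∧
      (∀ y ∈ Metric.ball x r, 0 < φ y → y ∈ F) ∧
      (∀ y ∈ Metric.ball x r, φ y < 0 → y ∉ F)

/-- `∫_{ℝⁿ ∖ B(x,ε)} (χ_{ℝⁿ∖F}(y) - χ_F(y)) K(x - y) dy`. -/
noncomputable def truncatedCurvature {n : ℕ} (K : EuclideanSpace ℝ (Fin n) → ℝ)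
    (F : Set (EuclideanSpace ℝ (Fin n))) (x : EuclideanSpace ℝ (Fin n)) (ε : ℝ) : ℝ :=
  ∫ y in (Metric.ball x ε)ᶜ,
    (Fᶜ.indicator (fun _ => (1 : ℝ)) y - F.indicator (fun _ => (1 : ℝ)) y) * K (x - y) ∂volume

/-- The `K`-curvature of `F` at `x`, as a principal value, exists and equals `h`. -/
def HasKCurvature {n : ℕ} (K : EuclideanSpace ℝ (Fin n) → ℝ)
    (F : Set (EuclideanSpace ℝ (Fin n))) (x : EuclideanSpace ℝ (Fin n)) (h : ℝ) : Prop :=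
  Tendsto (fun ε => truncatedCurvature K F x ε) (𝓝[>] (0 : ℝ)) (𝓝 h)

/-- `H^K_E(x) ≥ c` in the viscosity sense (used at points `x ∈ ∂E`): every set `F ⊆ E` with
compact boundary of class `C^{1,1}` and `x ∈ ∂F` has `H^K_F(x) ≥ c`. -/
def ViscosityCurvatureGE {n : ℕ} (K : EuclideanSpace ℝ (Fin n) → ℝ)
    (E : Set (EuclideanSpace ℝ (Fin n))) (x : EuclideanSpace ℝ (Fin n)) (c : ℝ) : Prop :=
  ∀ F : Set (EuclideanSpace ℝ (Fin n)), F ⊆ E → IsCompact (frontier F) → HasC11Boundary F →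
    x ∈ frontier F → ∃ h : ℝ, HasKCurvature K F x h ∧ c ≤ h

/-- `E` is strongly `K`-mean convex with associated constant `δ ≥ 0`. Here
`Metric.cthickening lam E` is `{x : d(x, E) ≤ lam}`, which is `E` for `lam = 0`. -/
def IsStronglyKMeanConvex {n : ℕ} (K : EuclideanSpace ℝ (Fin n) → ℝ)
    (δ : ℝ) (E : Set (EuclideanSpace ℝ (Fin n))) : Prop :=
  IsClosed E ∧ 0 ≤ δ ∧ ∃ ξ : ℝ, 0 < ξ ∧ ∀ lam ∈ Icc (0 : ℝ) ξ,
    ∀ x ∈ frontier (Metric.cthickening lam E),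
      ViscosityCurvatureGE K (Metric.cthickening lam E) x δ

/-- The `K`-perimeter of `E` in `Ω`, with values in `[0, ∞]`. -/
noncomputable def perimeter {n : ℕ} (K : EuclideanSpace ℝ (Fin n) → ℝ)
    (E Ω : Set (EuclideanSpace ℝ (Fin n))) : ℝ≥0∞ :=
  (∫⁻ x in E, ∫⁻ y in Ω \ E, ENNReal.ofReal (K (x - y)) ∂volume ∂volume) +
  ∫⁻ x in E ∩ Ω, ∫⁻ y in (Ω ∪ E)ᶜ, ENNReal.ofReal (K (x - y)) ∂volume ∂volume

/-- `A ⊂⊂ Ω`. -/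
def CompactlyIn {n : ℕ} (A Ω : Set (EuclideanSpace ℝ (Fin n))) : Prop :=
  IsCompact (closure A) ∧ closure A ⊆ Ω

/-- `E` is a `K`-outward minimizing set in `Ω`; the competitors are the Lebesgue measurable
sets `F ⊇ E` with `F ∖ E ⊂⊂ Ω`. -/
def IsKOutwardMinimizing {n : ℕ} (K : EuclideanSpace ℝ (Fin n) → ℝ)
    (E Ω : Set (EuclideanSpace ℝ (Fin n))) : Prop :=
  ∀ F : Set (EuclideanSpace ℝ (Fin n)), NullMeasurableSet F volume → E ⊆ F →
    CompactlyIn (F \ E) Ω → perimeter K E Ω ≤ perimeter K F Ω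

/-- `E` is a strongly `K`-outward minimizing set in `Ω` with associated constant `δ > 0`. -/
def IsStronglyKOutwardMinimizing {n : ℕ} (K : EuclideanSpace ℝ (Fin n) → ℝ)
    (δ : ℝ) (E Ω : Set (EuclideanSpace ℝ (Fin n))) : Prop :=
  0 < δ ∧ ∀ F : Set (EuclideanSpace ℝ (Fin n)), NullMeasurableSet F volume → E ⊆ F →
    CompactlyIn (F \ E) Ω →
      perimeter K E Ω + ENNReal.ofReal δ * volume (F \ E) ≤ perimeter K F Ω

end KPer

/-! Both parts are one calibration argument. For `E ⊆ F ⊆ Ω` and `G = F \ E`, with `I` the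
interaction energy, the perimeter difference `Per(F) - Per(E)` is `I(G, Fᶜ) - I(G, E)` when energies
are finite. Foliate `G` by the level sets of a function `u`, and at each `y ∈ G` compare the kernel
mass on the two sides of the leaf through `y`. Integrating over `G`, the interactions of `G` with
itself cancel because the kernel is even, and only `I(G, Fᶜ)` and `I(G, E)` survive. A bound on the
curvature of the leaves thus becomes a bound on the perimeter difference
(`interaction_add_le_of_levelSets`).

In part 2 the leaves are the boundaries of the outer parallel sets of `E`. A uniform two-sided ball
condition makes these sets `C^{1,1}`, so each may serve as its own test set in the viscosity
inequality.

Part 1 goes by contradiction. If a test set `F ⊆ E` has curvature below `δ` at `x`, take a ball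
inside `F` touching `∂F` only at `x` and enlarge it slightly to `A`. The part `A \ E` lies near `x`,
has positive volume, and is foliated by spheres concentric with `A`. At its points `y` the union of
`E` and the concentric ball through `y` has truncated curvature at most `δ - η`, so adding `A \ E`
contradicts minimality.

The kernel is singular, so the calibration is run for truncated kernels, followed by monotone
convergence. Tangential integrability controls the truncation error: inside a small ball, reflection
in `y` exchanges the two touching balls, and only the thin region between them remains. An interior
touching ball bounds the curvature from above uniformly in the truncation, which is all that part 1
needs at points `y ≠ x`. -/

set_option linter.unusedSectionVars false

namespace KPer

/-! ### Interaction energies and the calibration inequality -/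

section Interaction

variable {V : Type*} [NormedAddCommGroup V] [InnerProductSpace ℝ V] [FiniteDimensional ℝ V]
  [MeasureSpace V] [BorelSpace V] [(volume : Measure V).IsAddHaarMeasure]

/-- The measure with density `y ↦ k (x - y)`. -/
noncomputable def kernelMeasure (k : V → ℝ≥0∞) (x : V) : Measure V :=
  volume.withDensity fun y => k (x - y)

/-- The interaction energy `∫_A ∫_B k(x - y) dy dx`. -/
noncomputable def interaction (k : V → ℝ≥0∞) (A B : Set V) : ℝ≥0∞ :=
  ∫⁻ x in A, ∫⁻ y in B, k (x - y)

/-- The kernel `k` cut off inside the ball of radius `ε`. -/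
noncomputable def truncation (k : V → ℝ≥0∞) (ε : ℝ) : V → ℝ≥0∞ :=
  {w | ε ≤ ‖w‖}.indicator k

variable {k : V → ℝ≥0∞}

theorem kernelMeasure_apply (k : V → ℝ≥0∞) (x : V) (B : Set V) :
    kernelMeasure k x B = ∫⁻ y in B, k (x - y) :=
  withDensity_apply' _ _

theorem kernelMeasure_absolutelyContinuous (k : V → ℝ≥0∞) (x : V) :
    kernelMeasure k x ≪ volume :=
  withDensity_absolutelyContinuous _ _

theorem kernelMeasure_univ (k : V → ℝ≥0∞) (x : V) :
    kernelMeasure k x univ = ∫⁻ y, k y := by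
  rw [kernelMeasure_apply, setLIntegral_univ, lintegral_sub_left_eq_self]

theorem interaction_eq_lintegral_kernelMeasure (k : V → ℝ≥0∞) (A B : Set V) :
    interaction k A B = ∫⁻ x in A, kernelMeasure k x B := by
  simp_rw [kernelMeasure_apply]; rfl

theorem measurableSet_le_norm (ε : ℝ) : MeasurableSet {w : V | ε ≤ ‖w‖} :=
  measurableSet_le measurable_const measurable_norm

theorem aemeasurable_truncation (hk : AEMeasurable k volume) (ε : ℝ) :
    AEMeasurable (truncation k ε) volume :=
  hk.indicator (measurableSet_le_norm ε)

theorem truncation_neg (heven : ∀ w, k (-w) = k w) (ε : ℝ) (w : V) :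
    truncation k ε (-w) = truncation k ε w := by
  simp [truncation, indicator, heven]

theorem truncation_le (k : V → ℝ≥0∞) (ε : ℝ) (w : V) : truncation k ε w ≤ k w :=
  indicator_le_self _ _ _

theorem aemeasurable_comp_sub (hk : AEMeasurable k volume) (A B : Set V) :
    AEMeasurable (fun p : V × V => k (p.1 - p.2))
      ((volume.restrict A).prod (volume.restrict B)) := by
  rw [Measure.prod_restrict]
  exact (hk.comp_quasiMeasurePreserving (quasiMeasurePreserving_sub volume volume)).restrict

theorem aemeasurable_kernelMeasure (hk : AEMeasurable k volume) (A B : Set V) :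
    AEMeasurable (fun x => kernelMeasure k x B) (volume.restrict A) := by
  simp_rw [kernelMeasure_apply]
  exact (aemeasurable_comp_sub hk A B).lintegral_prod_right'

theorem interaction_comm (hk : AEMeasurable k volume) (heven : ∀ w, k (-w) = k w)
    (A B : Set V) : interaction k A B = interaction k B A := by
  unfold interaction
  rw [lintegral_lintegral_swap (aemeasurable_comp_sub hk A B)]
  refine lintegral_congr fun y => lintegral_congr fun x => ?_
  rw [← heven, neg_sub]

theorem interaction_mono_right (k : V → ℝ≥0∞) (A : Set V) {B C : Set V} (h : B ⊆ C) :
    interaction k A B ≤ interaction k A C :=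
  lintegral_mono fun _ => lintegral_mono_set h

theorem interaction_mono_kernel {k' : V → ℝ≥0∞} (h : ∀ w, k w ≤ k' w) (A B : Set V) :
    interaction k A B ≤ interaction k' A B :=
  lintegral_mono fun _ => lintegral_mono fun _ => h _

theorem interaction_union_right (hk : AEMeasurable k volume) (A : Set V) {B C : Set V}
    (hBC : Disjoint B C) (hC : NullMeasurableSet C volume) :
    interaction k A (B ∪ C) = interaction k A B + interaction k A C := by
  simp_rw [interaction_eq_lintegral_kernelMeasure]
  rw [← lintegral_add_left' (aemeasurable_kernelMeasure hk A B)]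
  refine lintegral_congr fun x => measure_union₀ ?_ hBC.aedisjoint
  exact hC.mono_ac (kernelMeasure_absolutelyContinuous k x)

theorem interaction_union_left (hk : AEMeasurable k volume) (heven : ∀ w, k (-w) = k w)
    (A : Set V) {B C : Set V} (hBC : Disjoint B C) (hC : NullMeasurableSet C volume) :
    interaction k (B ∪ C) A = interaction k B A + interaction k C A := by
  rw [interaction_comm hk heven, interaction_union_right hk A hBC hC,
    interaction_comm hk heven A, interaction_comm hk heven A]

theorem interaction_union_left_le (k : V → ℝ≥0∞) (A B C : Set V) :
    interaction k (A ∪ B) C ≤ interaction k A C + interaction k B C :=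
  lintegral_union_le _ _ _

/-- If the `k`-energy balance holds pointwise along the level sets of `u` in `G`, then it holds
in the integrated form, the mutual interactions of points of `G` cancelling by symmetry. -/
theorem interaction_add_le_of_levelSets (hk : AEMeasurable k volume)
    (heven : ∀ w, k (-w) = k w) (hfin : ∫⁻ w, k w ≠ ∞) {u : V → ℝ} (hu : Measurable u)
    {G P Q : Set V} (hG : NullMeasurableSet G volume) (hGfin : volume G ≠ ∞)
    (hQG : Disjoint Q G) {a b : ℝ≥0∞}
    (h : ∀ y ∈ G, kernelMeasure k y (Q ∪ G ∩ {z | u y ≤ u z}) + a ≤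
      kernelMeasure k y (P ∪ G ∩ {z | u z < u y}) + b) :
    interaction k G Q + a * volume G ≤ interaction k G P + b * volume G := by
  set X : V → ℝ≥0∞ := fun y => kernelMeasure k y (G ∩ {z | u y ≤ u z}) with hX
  set Y : V → ℝ≥0∞ := fun y => kernelMeasure k y (G ∩ {z | u z < u y}) with hY
  -- Finiteness allows the self-interaction of `G` to be cancelled at the end; this is why the
  -- kernel must be truncated.
  have hXfin : ∫⁻ y in G, X y ≠ ∞ := by
    refine ne_top_of_le_ne_top (ENNReal.mul_ne_top hfin hGfin) ?_
    rw [← setLIntegral_const]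
    refine lintegral_mono fun y => ?_
    rw [← kernelMeasure_univ k y]
    exact measure_mono (subset_univ _)
  -- Tonelli and evenness exchange the roles of `y` and `z`, turning the strict sublevel region into
  -- a strict superlevel one.
  have hYX : ∫⁻ y in G, Y y ≤ ∫⁻ y in G, X y := by
    have hmeas : ∀ y, MeasurableSet {z | u z < u y} := fun y =>
      measurableSet_lt hu measurable_const
    have hY' : ∀ y, Y y = ∫⁻ z in G, {z | u z < u y}.indicator (fun z => k (y - z)) z := by
      intro y
      rw [lintegral_indicator (hmeas y), Measure.restrict_restrict (hmeas y),
        ← kernelMeasure_apply, inter_comm]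
    simp_rw [hY']
    rw [lintegral_lintegral_swap]
    · refine lintegral_mono fun z => ?_
      have hm : MeasurableSet {y | u z ≤ u y} := measurableSet_le measurable_const hu
      rw [hX]
      simp only
      rw [kernelMeasure_apply, inter_comm, ← Measure.restrict_restrict hm,
        ← lintegral_indicator hm]
      refine lintegral_mono fun y => ?_
      by_cases hzy : u z < u y
      · simp only [indicator, mem_ofPred_eq, hzy, hzy.le, if_true]
        rw [← heven, neg_sub]
      · simp [indicator, hzy]
    · have : (Function.uncurry fun y z => {z | u z < u y}.indicator (fun z => k (y - z)) z) =
          {p : V × V | u p.2 < u p.1}.indicator (fun p => k (p.1 - p.2)) := by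
        ext ⟨y, z⟩; simp [Function.uncurry, indicator]
      rw [this]
      exact (aemeasurable_comp_sub hk G G).indicator
        (measurableSet_lt (hu.comp measurable_snd) (hu.comp measurable_fst))
  have hint : interaction k G Q + (∫⁻ y in G, X y) + a * volume G ≤
      interaction k G P + ((∫⁻ y in G, Y y) + b * volume G) := by
    simp_rw [interaction_eq_lintegral_kernelMeasure]
    calc (∫⁻ y in G, kernelMeasure k y Q) + (∫⁻ y in G, X y) + a * volume G
        ≤ ∫⁻ y in G, (kernelMeasure k y Q + X y + a) := by
          rw [← setLIntegral_const]
          exact (add_le_add_left (le_lintegral_add _ _) _).trans (le_lintegral_add _ _)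
      _ ≤ ∫⁻ y in G, (kernelMeasure k y P + (Y y + b)) := by
          refine lintegral_mono_ae ?_
          filter_upwards [ae_restrict_mem₀ hG] with y hy
          have hXm : NullMeasurableSet (G ∩ {z | u y ≤ u z}) (kernelMeasure k y) :=
            (hG.inter (measurableSet_le measurable_const hu).nullMeasurableSet).mono_ac
              (kernelMeasure_absolutelyContinuous k y)
          rw [hX]
          simp only
          rw [← measure_union₀ hXm (hQG.mono_right inter_subset_left).aedisjoint, ← add_assoc]
          exact (h y hy).trans (add_le_add_left (measure_union_le _ _) _)
      _ = _ := by
          rw [lintegral_add_left' (aemeasurable_kernelMeasure hk G P),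
            lintegral_add_right _ measurable_const, setLIntegral_const]
  have h2 : (interaction k G Q + a * volume G) + ∫⁻ y in G, X y ≤
      (interaction k G P + b * volume G) + ∫⁻ y in G, X y := by
    calc _ = interaction k G Q + (∫⁻ y in G, X y) + a * volume G := by ring
      _ ≤ _ := hint
      _ ≤ interaction k G P + ((∫⁻ y in G, X y) + b * volume G) := by gcongr
      _ = _ := by ring
  exact (ENNReal.add_le_add_iff_right hXfin).1 h2

theorem interaction_eq_lintegral_prod (hk : AEMeasurable k volume) (A B : Set V) :
    interaction k A B =
      ∫⁻ p, k (p.1 - p.2) ∂((volume.restrict A).prod (volume.restrict B)) :=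
  (lintegral_prod _ (aemeasurable_comp_sub hk A B)).symm

/-- Inequalities for all truncated kernels pass to the limit. -/
theorem interaction_add_le_of_truncation (hk : AEMeasurable k volume) {A B : Set V}
    (hA : NullMeasurableSet A volume) (hB : NullMeasurableSet B volume) (hAB : Disjoint A B)
    {r : ℝ} (hr : 0 < r) {a b : ℝ≥0∞}
    (h : ∀ ε, 0 < ε → ε < r → interaction (truncation k ε) A B + a ≤ b) :
    interaction k A B + a ≤ b := by
  -- The shift by 2 keeps the radius strictly below `r` already for `m = 0`.
  have hlim : Tendsto (fun m : ℕ => r / ((m : ℝ) + 2)) atTop (𝓝 0) :=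
    tendsto_const_nhds.div_atTop
      (tendsto_atTop_add_const_right _ _ tendsto_natCast_atTop_atTop)
  have hpos : ∀ m : ℕ, 0 < r / ((m : ℝ) + 2) := fun m => by positivity
  have hlt : ∀ m : ℕ, r / ((m : ℝ) + 2) < r := fun m => by
    rw [div_lt_iff₀ (by positivity)]
    nlinarith [(Nat.cast_nonneg m : (0 : ℝ) ≤ m)]
  have hanti : Antitone fun m : ℕ => r / ((m : ℝ) + 2) := fun i j hij => by
    have : (i : ℝ) ≤ j := by exact_mod_cast hij
    simp only
    gcongr
  have key : interaction k A B = ⨆ m : ℕ, interaction (truncation k (r / ((m : ℝ) + 2))) A B := by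
    rw [interaction_eq_lintegral_prod hk]
    simp_rw [fun m : ℕ =>
      interaction_eq_lintegral_prod (aemeasurable_truncation hk (r / ((m : ℝ) + 2))) A B]
    rw [← lintegral_iSup' (fun m => aemeasurable_comp_sub (aemeasurable_truncation hk _) A B)]
    · refine lintegral_congr_ae ?_
      have hmem : ∀ᵐ p ∂((volume.restrict A).prod (volume.restrict B)), p ∈ A ×ˢ B := by
        rw [Measure.prod_restrict]
        exact ae_restrict_mem₀ (hA.prod hB)
      filter_upwards [hmem] with p hp
      -- Disjointness keeps pairs off the diagonal, so every pair is eventually untouched by the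
      -- truncation.
      have hne : 0 < ‖p.1 - p.2‖ :=
        norm_pos_iff.2 (sub_ne_zero.2 (hAB.ne_of_mem hp.1 hp.2))
      refine le_antisymm ?_ (iSup_le fun m => truncation_le _ _ _)
      obtain ⟨m, hm⟩ := (hlim.eventually_le_const hne).exists
      refine le_iSup_of_le m ?_
      simp [truncation, indicator, hm]
    · refine ae_of_all _ fun p i j hij => ?_
      exact indicator_le_indicator_of_subset
        (fun w hw => (hanti hij).trans hw) (fun _ => zero_le) _
  rw [key, ENNReal.iSup_add]
  exact iSup_le fun m => h _ (hpos m) (hlt m)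

end Interaction

/-! ### Finite perimeter of balls, and continuity under translation -/

section Perimeter

variable {V : Type*} [NormedAddCommGroup V] [InnerProductSpace ℝ V] [FiniteDimensional ℝ V]
  [MeasureSpace V] [BorelSpace V] [(volume : Measure V).IsAddHaarMeasure]

/-- A point that leaves the ball when translated by `-w` lies in a boundary shell of width `s = min
‖w‖ R`. The shell volume is at most `d s R^(d-1)` times that of the unit ball, and `s ≤ max 1 R *
min 1 ‖w‖` produces the weight in which the kernel is integrable. -/
theorem volume_ball_inter_translate_compl_le [Nontrivial V] (c : V) {R : ℝ} (hR : 0 < R) (w : V) :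
    volume (Metric.ball c R ∩ {x | x - w ∉ Metric.ball c R}) ≤
      (ENNReal.ofReal (max 1 R * (Module.finrank ℝ V * R ^ (Module.finrank ℝ V - 1))) *
        volume (Metric.ball (0 : V) 1)) * ENNReal.ofReal (min 1 ‖w‖) := by
  set d := Module.finrank ℝ V
  set s := min ‖w‖ R with hs
  have hs0 : 0 ≤ s := le_min (norm_nonneg _) hR.le
  have hsR : s ≤ R := min_le_right _ _
  have hsub : Metric.ball c R ∩ {x | x - w ∉ Metric.ball c R} ⊆
      Metric.ball c R \ Metric.ball c (R - s) := by
    rintro x ⟨hx, hxw⟩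
    refine ⟨hx, fun hx' => hxw ?_⟩
    rw [Metric.mem_ball, dist_eq_norm] at hx' ⊢
    have hsw : s = ‖w‖ := by
      rcases le_total ‖w‖ R with h | h
      · rw [hs, min_eq_left h]
      · rw [hs, min_eq_right h, sub_self] at hx'
        exact absurd hx' (norm_nonneg _).not_gt
    calc ‖x - w - c‖ = ‖(x - c) - w‖ := by congr 1; abel
      _ ≤ ‖x - c‖ + ‖w‖ := norm_sub_le _ _
      _ < R := by linarith
  refine (measure_mono hsub).trans ?_
  rw [measure_sdiff (Metric.ball_subset_ball (by linarith)) measurableSet_ball.nullMeasurableSet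
    measure_ball_lt_top.ne, Measure.addHaar_ball _ _ hR.le,
    Measure.addHaar_ball _ _ (by linarith : (0 : ℝ) ≤ R - s),
    ← ENNReal.sub_mul (fun _ _ => measure_ball_lt_top.ne),
    ← ENNReal.ofReal_sub _ (pow_nonneg (by linarith) _),
    mul_right_comm, ← ENNReal.ofReal_mul (by positivity)]
  gcongr
  have h1 : R ^ d - (R - s) ^ d ≤ s * d * R ^ (d - 1) := by
    have := abs_pow_sub_pow_le R (R - s) d
    rw [abs_of_nonneg hR.le, abs_of_nonneg (by linarith : (0 : ℝ) ≤ R - s),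
      max_eq_left (by linarith), sub_sub_cancel, abs_of_nonneg hs0] at this
    exact (le_abs_self _).trans this
  have h2 : s ≤ max 1 R * min 1 ‖w‖ := by
    rcases le_total 1 ‖w‖ with h | h
    · rw [min_eq_left h, mul_one]; exact hsR.trans (le_max_right _ _)
    · rw [min_eq_right h]
      refine (min_le_left _ _).trans ?_
      nlinarith [le_max_left 1 R, norm_nonneg w]
  calc _ ≤ s * d * R ^ (d - 1) := h1
    _ ≤ max 1 R * min 1 ‖w‖ * d * R ^ (d - 1) := by gcongr
    _ = _ := by ring

variable {k : V → ℝ≥0∞}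

/-- Balls have finite perimeter. -/
theorem interaction_ball_compl_ne_top [Nontrivial V] (hk : AEMeasurable k volume)
    (hfin : ∫⁻ w, ENNReal.ofReal (min 1 ‖w‖) * k w ≠ ∞) (c : V) {R : ℝ} (hR : 0 < R) :
    interaction k (Metric.ball c R) (Metric.ball c R)ᶜ ≠ ∞ := by
  set B := Metric.ball c R with hB
  have hBm : MeasurableSet B := measurableSet_ball
  -- Substitute `w = x - y` and apply Tonelli: the energy becomes an average of the volumes lost
  -- under translation.
  have h1 : interaction k B Bᶜ =
      ∫⁻ w, k w * volume (B ∩ {x | x - w ∉ B}) := by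
    have hm : ∀ x, MeasurableSet {w | x - w ∈ Bᶜ} := fun x =>
      (measurable_const.sub measurable_id) hBm.compl
    have : ∀ x, ∫⁻ y in Bᶜ, k (x - y) = ∫⁻ w, {w | x - w ∈ Bᶜ}.indicator k w := by
      intro x
      rw [← lintegral_indicator hBm.compl, ← lintegral_sub_left_eq_self _ x]
      refine lintegral_congr fun w => ?_
      simp [indicator]
    unfold interaction
    simp_rw [this]
    rw [lintegral_lintegral_swap]
    · refine lintegral_congr fun w => ?_
      have hm' : MeasurableSet {x | x - w ∈ Bᶜ} :=
        (measurable_id.sub measurable_const) hBm.compl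
      have : ∀ x, {w | x - w ∈ Bᶜ}.indicator k w = {x | x - w ∈ Bᶜ}.indicator (fun _ => k w) x :=
        fun x => by simp [indicator]
      simp_rw [this]
      rw [lintegral_indicator hm', setLIntegral_const, Measure.restrict_apply hm', inter_comm]
      rfl
    · have : (Function.uncurry fun x w => {w | x - w ∈ Bᶜ}.indicator k w) =
          {p : V × V | p.1 - p.2 ∈ Bᶜ}.indicator (fun p => k p.2) := by
        ext ⟨x, w⟩; simp [Function.uncurry, indicator]
      rw [this]
      refine AEMeasurable.indicator ?_ ((measurable_fst.sub measurable_snd) hBm.compl)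
      exact hk.comp_quasiMeasurePreserving Measure.quasiMeasurePreserving_snd
  rw [h1]
  set C := (ENNReal.ofReal (max 1 R * (Module.finrank ℝ V * R ^ (Module.finrank ℝ V - 1))) *
        volume (Metric.ball (0 : V) 1)) with hC
  have hCfin : C ≠ ∞ := ENNReal.mul_ne_top ENNReal.ofReal_ne_top measure_ball_lt_top.ne
  refine ne_top_of_le_ne_top (ENNReal.mul_ne_top hCfin hfin) ?_
  rw [← lintegral_const_mul' _ _ hCfin]
  refine lintegral_mono fun w => ?_
  calc _ ≤ k w * (C * ENNReal.ofReal (min 1 ‖w‖)) := by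
        gcongr; exact volume_ball_inter_translate_compl_le c hR w
    _ = _ := by ring

/-- The union of two sets of finite perimeter has finite perimeter. -/
theorem interaction_union_compl_ne_top {A B : Set V} (hA : interaction k A Aᶜ ≠ ∞)
    (hB : interaction k B Bᶜ ≠ ∞) : interaction k (A ∪ B) (A ∪ B)ᶜ ≠ ∞ := by
  refine ne_top_of_le_ne_top (ENNReal.add_ne_top.2 ⟨hA, hB⟩)
    ((interaction_union_left_le _ _ _ _).trans (add_le_add ?_ ?_))
  · exact interaction_mono_right _ _ (compl_subset_compl.2 subset_union_left)
  · exact interaction_mono_right _ _ (compl_subset_compl.2 subset_union_right)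

/-- A compact subset of an open set is contained in a measurable set of finite perimeter which
is compactly contained in the open set. -/
theorem exists_superset_interaction_compl_ne_top [Nontrivial V] (hk : AEMeasurable k volume)
    (hfin : ∫⁻ w, ENNReal.ofReal (min 1 ‖w‖) * k w ≠ ∞) {S Ω : Set V} (hS : IsCompact S)
    (hΩ : IsOpen Ω) (hSΩ : S ⊆ Ω) :
    ∃ F, MeasurableSet F ∧ S ⊆ F ∧ IsCompact (closure F) ∧ closure F ⊆ Ω ∧
      interaction k F Fᶜ ≠ ∞ := by
  refine hS.induction_on (p := fun S => ∃ F, MeasurableSet F ∧ S ⊆ F ∧ IsCompact (closure F) ∧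
    closure F ⊆ Ω ∧ interaction k F Fᶜ ≠ ∞) ?_ ?_ ?_ ?_
  · exact ⟨∅, MeasurableSet.empty, subset_rfl, by simp, by simp, by simp [interaction]⟩
  · rintro s t hst ⟨F, h1, h2, h3⟩
    exact ⟨F, h1, hst.trans h2, h3⟩
  · rintro s t ⟨F, h1, h2, h3, h4, h5⟩ ⟨F', h1', h2', h3', h4', h5'⟩
    refine ⟨F ∪ F', h1.union h1', union_subset_union h2 h2', ?_, ?_,
      interaction_union_compl_ne_top h5 h5'⟩
    · rw [closure_union]; exact h3.union h3'
    · rw [closure_union]; exact union_subset h4 h4'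
  · intro x hx
    obtain ⟨R, hR, hRΩ⟩ := Metric.nhds_basis_closedBall.mem_iff.1 (hΩ.mem_nhds (hSΩ hx))
    refine ⟨Metric.ball x R, mem_nhdsWithin_of_mem_nhds (Metric.ball_mem_nhds x hR),
      Metric.ball x R, measurableSet_ball, subset_rfl, ?_, ?_,
      interaction_ball_compl_ne_top hk hfin x hR⟩
    · exact (isCompact_closedBall x R).of_isClosed_subset isClosed_closure
        Metric.closure_ball_subset_closedBall
    · exact Metric.closure_ball_subset_closedBall.trans hRΩ

/-- Continuity of translations in `L¹`. -/
theorem tendsto_lintegral_enorm_translate_sub {f : V → ℝ} (hf : Integrable f) :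
    Tendsto (fun a : V => ∫⁻ z, ‖f (a + z) - f z‖ₑ) (𝓝 0) (𝓝 0) := by
  have hf1 : MemLp f 1 volume := memLp_one_iff_integrable.2 hf
  have : Fact ((1 : ℝ≥0∞) ≠ ∞) := ⟨ENNReal.one_ne_top⟩
  have hcont : Continuous fun a : V => DomAddAct.mk a +ᵥ hf1.toLp f :=
    DomAddAct.continuous_mk.vadd continuous_const
  have h : Tendsto (fun a : V => ‖(DomAddAct.mk a +ᵥ hf1.toLp f) - hf1.toLp f‖ₑ) (𝓝 0)
      (𝓝 ‖(DomAddAct.mk (0 : V) +ᵥ hf1.toLp f) - hf1.toLp f‖ₑ) :=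
    ((hcont.sub continuous_const).enorm).tendsto 0
  rw [DomAddAct.mk_zero, zero_vadd, sub_self, enorm_zero] at h
  refine h.congr fun a => ?_
  rw [DomAddAct.mk_vadd_toLp, ← MemLp.toLp_sub, Lp.enorm_toLp, eLpNorm_one_eq_lintegral_enorm]
  rfl

/-- The measures with translated integrable density depend continuously on the translation, in
total variation. -/
theorem eventually_kernelMeasure_le_add {f : V → ℝ} (hf : Integrable f) (x : V) {η : ℝ}
    (hη : 0 < η) : ∀ᶠ y in 𝓝 x, ∀ S, kernelMeasure (fun w => ENNReal.ofReal (f w)) y S ≤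
      kernelMeasure (fun w => ENNReal.ofReal (f w)) x S + ENNReal.ofReal η := by
  have h0 : Tendsto (fun y : V => y - x) (𝓝 x) (𝓝 0) := by
    exact tendsto_sub_nhds_zero_iff.2 tendsto_id
  filter_upwards [((tendsto_lintegral_enorm_translate_sub hf).comp h0).eventually_le_const
    (ENNReal.ofReal_pos.2 hη)] with y hy S
  have hnorm : ∫⁻ z, ‖f (y - z) - f (x - z)‖ₑ = ∫⁻ z, ‖f (y - x + z) - f z‖ₑ := by
    rw [← lintegral_sub_left_eq_self (fun z => ‖f (y - x + z) - f z‖ₑ) x]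
    refine lintegral_congr fun z => ?_
    rw [sub_add_sub_cancel]
  rw [kernelMeasure_apply, kernelMeasure_apply]
  calc ∫⁻ z in S, ENNReal.ofReal (f (y - z))
      ≤ ∫⁻ z in S, (ENNReal.ofReal (f (x - z)) + ‖f (y - z) - f (x - z)‖ₑ) := by
        refine lintegral_mono fun z => ?_
        rw [← ofReal_norm]
        refine le_trans ?_ ENNReal.ofReal_add_le
        refine ENNReal.ofReal_le_ofReal ?_
        have := le_abs_self (f (y - z) - f (x - z))
        rw [Real.norm_eq_abs]; linarith
    _ ≤ (∫⁻ z in S, ENNReal.ofReal (f (x - z))) + ∫⁻ z in S, ‖f (y - z) - f (x - z)‖ₑ := by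
        rw [lintegral_add_left']
        exact ((hf.aemeasurable.comp_quasiMeasurePreserving
          (quasiMeasurePreserving_sub_left volume x)).ennreal_ofReal).restrict
    _ ≤ _ := by
        gcongr
        exact (setLIntegral_le_lintegral _ _).trans (hnorm.trans_le hy)

end Perimeter

/-- For `E ⊆ Ω` the two terms of the definition integrate over a partition of `Eᶜ`, so the
dependence on `Ω` disappears. -/
theorem perimeter_eq_interaction {n : ℕ} {K : EuclideanSpace ℝ (Fin n) → ℝ}
    (hK : AEMeasurable (fun w => ENNReal.ofReal (K w)) volume)
    {E Ω : Set (EuclideanSpace ℝ (Fin n))} (hE : NullMeasurableSet E volume) (hΩ : IsOpen Ω)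
    (hEΩ : E ⊆ Ω) :
    perimeter K E Ω = interaction (fun w => ENNReal.ofReal (K w)) E Eᶜ := by
  have hc : Eᶜ = (Ω \ E) ∪ (Ω ∪ E)ᶜ := by
    ext x; simp only [mem_compl_iff, mem_union, Set.mem_sdiff]; have := @hEΩ x; tauto
  rw [hc, interaction_union_right hK]
  · rw [perimeter, inter_eq_left.2 hEΩ]; rfl
  · exact disjoint_left.2 fun x hx hx' => hx' (Or.inl hx.1)
  · exact (hΩ.measurableSet.nullMeasurableSet.union hE).compl

/-! ### Two-sided touching balls for `C^{1,1}` boundaries -/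

section TouchingBalls

variable {V : Type*} [NormedAddCommGroup V] [InnerProductSpace ℝ V]

/-- `F` has an interior and an exterior ball of radius `ρ` touching at `x`, with outward unit
normal `ν`. -/
def HasTouchingBalls (F : Set V) (ρ : ℝ) (x ν : V) : Prop :=
  ‖ν‖ = 1 ∧ Metric.ball (x - ρ • ν) ρ ⊆ F ∧ Metric.ball (x + ρ • ν) ρ ⊆ Fᶜ

theorem mem_ball_add_smul_iff {x ν y : V} {ρ : ℝ} (hρ : 0 < ρ) (hν : ‖ν‖ = 1) :
    y ∈ Metric.ball (x + ρ • ν) ρ ↔ ‖y - x‖ ^ 2 < 2 * ρ * inner ℝ (y - x) ν := by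
  rw [Metric.mem_ball, dist_eq_norm, ← sub_sub, ← sq_lt_sq₀ (norm_nonneg _) hρ.le,
    norm_sub_sq_real, norm_smul, hν, inner_smul_right, Real.norm_of_nonneg hρ.le]
  constructor <;> intro h <;> linarith

theorem mem_ball_sub_smul_iff {x ν y : V} {ρ : ℝ} (hρ : 0 < ρ) (hν : ‖ν‖ = 1) :
    y ∈ Metric.ball (x - ρ • ν) ρ ↔ ‖y - x‖ ^ 2 < -(2 * ρ * inner ℝ (y - x) ν) := by
  have := mem_ball_add_smul_iff (x := x) (y := y) hρ (ν := -ν) (by rwa [norm_neg])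
  rw [smul_neg, ← sub_eq_add_neg, inner_neg_right] at this
  rw [this]
  constructor <;> intro h <;> linarith

theorem HasTouchingBalls.compl {F : Set V} {ρ : ℝ} {x ν : V} (h : HasTouchingBalls F ρ x ν) :
    HasTouchingBalls Fᶜ ρ x (-ν) := by
  refine ⟨by rw [norm_neg]; exact h.1, ?_, ?_⟩
  · rw [smul_neg, sub_neg_eq_add]; exact h.2.2
  · rw [smul_neg, ← sub_eq_add_neg, compl_compl]; exact h.2.1

theorem HasTouchingBalls.mono {F : Set V} {ρ ρ' : ℝ} {x ν : V} (h : HasTouchingBalls F ρ x ν)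
    (h' : ρ' ≤ ρ) : HasTouchingBalls F ρ' x ν := by
  have hd : ‖(ρ - ρ') • ν‖ = ρ - ρ' := by
    rw [norm_smul, h.1, mul_one, Real.norm_of_nonneg (by linarith)]
  refine ⟨h.1, (Metric.ball_subset_ball' ?_).trans h.2.1,
    (Metric.ball_subset_ball' ?_).trans h.2.2⟩
  · rw [dist_eq_norm, show x - ρ' • ν - (x - ρ • ν) = (ρ - ρ') • ν by rw [sub_smul]; abel, hd]
    linarith
  · rw [dist_eq_norm, show x + ρ' • ν - (x + ρ • ν) = -((ρ - ρ') • ν) by rw [sub_smul]; abel,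
      norm_neg, hd]
    linarith

theorem HasTouchingBalls.mem_frontier {F : Set V} {ρ : ℝ} {x ν : V}
    (h : HasTouchingBalls F ρ x ν) (hρ : 0 < ρ) : x ∈ frontier F := by
  have hn : ‖ρ • ν‖ = ρ := by rw [norm_smul, h.1, mul_one, Real.norm_of_nonneg hρ.le]
  rw [frontier_eq_closure_inter_closure]
  constructor
  · refine closure_mono h.2.1 ?_
    rw [closure_ball _ hρ.ne', Metric.mem_closedBall, dist_eq_norm, sub_sub_cancel, hn]
  · refine closure_mono h.2.2 ?_
    rw [closure_ball _ hρ.ne', Metric.mem_closedBall, dist_eq_norm, sub_add_cancel_left,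
      norm_neg, hn]

/-- Second order Taylor estimate for functions with Lipschitz gradient. -/
theorem abs_sub_sub_inner_le [CompleteSpace V] {φ : V → ℝ} {g : V → V} {L : ℝ≥0} {x₀ : V}
    {r : ℝ} (hφ : ∀ y ∈ Metric.ball x₀ r, HasGradientAt φ (g y) y)
    (hg : LipschitzOnWith L g (Metric.ball x₀ r)) {x y : V} (hx : x ∈ Metric.ball x₀ r)
    (hy : y ∈ Metric.ball x₀ r) :
    |φ y - φ x - inner ℝ (g x) (y - x)| ≤ L * ‖y - x‖ ^ 2 := by
  set s := Metric.ball x₀ r ∩ Metric.closedBall x ‖y - x‖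
  have hs : Convex ℝ s := (convex_ball _ _).inter (convex_closedBall _ _)
  have h := hs.norm_image_sub_le_of_norm_hasFDerivWithin_le' (𝕜 := ℝ) (f := φ)
    (f' := fun z => InnerProductSpace.toDual ℝ V (g z)) (φ := InnerProductSpace.toDual ℝ V (g x))
    (C := L * ‖y - x‖) (x := x) (y := y)
    (fun z hz => (hφ z hz.1).hasFDerivAt.hasFDerivWithinAt) (fun z hz => ?_)
    ⟨hx, Metric.mem_closedBall_self (norm_nonneg _)⟩
    ⟨hy, by rw [Metric.mem_closedBall, dist_eq_norm]⟩
  · rw [InnerProductSpace.toDual_apply_apply, Real.norm_eq_abs] at h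
    rw [pow_two, ← mul_assoc]
    exact h
  · rw [← map_sub, LinearIsometryEquiv.norm_map]
    refine (hg.norm_sub_le hz.1 hx).trans ?_
    gcongr
    rw [← dist_eq_norm]
    exact hz.2

/-- A pointwise second order expansion whose remainder is quadratically bounded determines the
gradient. -/
theorem hasGradientAt_of_abs_sub_sub_inner_le [CompleteSpace V] {f : V → ℝ} {g p : V} {C : ℝ}
    (h : ∀ y, |f y - f p - inner ℝ g (y - p)| ≤ C * ‖y - p‖ ^ 2) : HasGradientAt f g p := by
  rw [hasGradientAt_iff_isLittleO]
  refine Asymptotics.IsBigO.trans_isLittleO (g := fun y => ‖y - p‖ ^ 2) ?_ ?_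
  · refine Asymptotics.IsBigO.of_bound C (Eventually.of_forall fun y => ?_)
    rw [Real.norm_eq_abs, norm_pow, norm_norm]
    exact h y
  · have h0 : Tendsto (fun y => ‖y - p‖) (𝓝 p) (𝓝 0) := by
      simpa using ((continuous_id.sub (continuous_const (y := p))).norm).tendsto p
    have := ((Asymptotics.isLittleO_pow_id (𝕜 := ℝ) (n := 2) one_lt_two).comp_tendsto h0)
    exact this.trans_isBigO (Asymptotics.isBigO_refl _ _).norm_left

/-- A pointwise second order expansion whose remainder is uniformly quadratically bounded has a
Lipschitz gradient. -/
theorem lipschitzOnWith_of_abs_sub_sub_inner_le {f : V → ℝ} {g : V → V} {C : ℝ≥0} {s : Set V}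
    (h : ∀ p ∈ s, ∀ y, |f y - f p - inner ℝ (g p) (y - p)| ≤ C * ‖y - p‖ ^ 2) :
    LipschitzOnWith (6 * C) g s := by
  refine LipschitzOnWith.of_dist_le_mul fun p hp q hq => ?_
  rw [dist_eq_norm, dist_eq_norm]
  set D := g p - g q with hD
  rcases eq_or_ne D 0 with h0 | h0
  · rw [h0, norm_zero]; positivity
  have hD0 : 0 < ‖D‖ := norm_pos_iff.2 h0
  set a := ‖p - q‖ with ha
  rcases (norm_nonneg (p - q)).eq_or_lt with ha0 | ha0
  · have : p = q := sub_eq_zero.1 (norm_eq_zero.1 ha0.symm)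
    exact absurd (by rw [hD, this, sub_self]) h0
  -- Test in the direction of the gradient jump, at length `‖p - q‖`. The expansions at `p` and `q`
  -- evaluated at `p + v`, and at `q` evaluated at `p`, have errors `C a²`, `4 C a²`, `C a²`, hence
  -- the factor 6.
  set v := (a / ‖D‖) • D with hv
  have hvn : ‖v‖ = a := by
    rw [hv, norm_smul, norm_div, norm_norm, ha, norm_norm, div_mul_cancel₀ _ hD0.ne']
  have hDv : inner ℝ D v = a * ‖D‖ := by
    rw [hv, inner_smul_right, real_inner_self_eq_norm_sq]; field_simp
  have e1 := abs_le.1 (h p hp (p + v))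
  have e2 := abs_le.1 (h q hq (p + v))
  have e3 := abs_le.1 (h q hq p)
  rw [add_sub_cancel_left, hvn] at e1
  have hle : ‖p + v - q‖ ^ 2 ≤ (2 * a) ^ 2 := by
    gcongr
    calc ‖p + v - q‖ = ‖(p - q) + v‖ := by congr 1; abel
      _ ≤ ‖p - q‖ + ‖v‖ := norm_add_le _ _
      _ = 2 * a := by rw [hvn, ← ha]; ring
  have e2' : (C : ℝ) * ‖p + v - q‖ ^ 2 ≤ C * (2 * a) ^ 2 := by gcongr
  have hsplit : inner ℝ (g q) (p + v - q) = inner ℝ (g q) (p - q) + inner ℝ (g q) v := by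
    rw [← inner_add_right]; congr 1; abel
  rw [hD, inner_sub_left] at hDv
  rw [← ha] at e3
  have hfin : a * ‖D‖ ≤ a * (6 * C * a) := by nlinarith
  push_cast
  exact le_of_mul_le_mul_left hfin ha0

/-- Uniform touching balls near a boundary point with a `C^{1,1}` defining function. -/
theorem exists_touchingBalls_of_gradient [CompleteSpace V] {F : Set V} {x₀ : V} {r : ℝ}
    (hr : 0 < r) {φ : V → ℝ} {g : V → V} {L : ℝ≥0}
    (hφ : ∀ y ∈ Metric.ball x₀ r, HasGradientAt φ (g y) y)
    (hg : LipschitzOnWith L g (Metric.ball x₀ r)) (hg0 : ∀ y ∈ Metric.ball x₀ r, g y ≠ 0)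
    (hpos : ∀ y ∈ Metric.ball x₀ r, 0 < φ y → y ∈ F)
    (hneg : ∀ y ∈ Metric.ball x₀ r, φ y < 0 → y ∉ F) :
    ∃ ρ : ℝ, 0 < ρ ∧ ∃ U ∈ 𝓝 x₀, ∀ x ∈ U ∩ frontier F, ∃ ν, HasTouchingBalls F ρ x ν := by
  set m := ‖g x₀‖ with hm
  have hm0 : 0 < m := norm_pos_iff.2 (hg0 _ (Metric.mem_ball_self hr))
  have hL : (0 : ℝ) < L + 1 := by positivity
  -- The first bound keeps the touching balls inside the chart. The second makes the linear term of
  -- `φ` beat the Taylor error on them; `L + 1` avoids division by zero.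
  set ρ := min (r / 4) (m / (4 * (L + 1))) with hρdef
  have hρ : 0 < ρ := lt_min (by positivity) (by positivity)
  set s := min (r / 2) (m / (2 * (L + 1))) with hs
  have hs0 : 0 < s := lt_min (by positivity) (by positivity)
  have hsr : s ≤ r / 2 := min_le_left _ _
  have hρr : ρ ≤ r / 4 := min_le_left _ _
  refine ⟨ρ, hρ, Metric.ball x₀ s, Metric.ball_mem_nhds _ hs0, ?_⟩
  rintro x ⟨hxs, hxF⟩
  have hxr : x ∈ Metric.ball x₀ r := Metric.ball_subset_ball (by linarith) hxs
  have hgx : m / 2 ≤ ‖g x‖ := by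
    have h1 := hg.norm_sub_le (Metric.mem_ball_self hr) hxr
    have h2 : ‖x₀ - x‖ ≤ m / (2 * (L + 1)) := by
      rw [← dist_eq_norm, dist_comm]
      exact (Metric.mem_ball.1 hxs).le.trans (min_le_right _ _)
    have h3 : (L : ℝ) * ‖x₀ - x‖ ≤ m / 2 := by
      calc (L : ℝ) * ‖x₀ - x‖ ≤ (L + 1) * (m / (2 * (L + 1))) := by gcongr; linarith
        _ = m / 2 := by field_simp
    have h4 := norm_sub_norm_le (g x₀) (g x)
    linarith
  have hφx : φ x = 0 := by
    have hc : ContinuousAt φ x := (hφ x hxr).differentiableAt.continuousAt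
    have hb : Metric.ball x₀ r ∈ 𝓝 x := Metric.isOpen_ball.mem_nhds hxr
    rw [frontier_eq_closure_inter_closure] at hxF
    refine le_antisymm (not_lt.1 fun h => ?_) (not_lt.1 fun h => ?_)
    · have : F ∈ 𝓝 x := by
        filter_upwards [hb, hc.eventually (lt_mem_nhds h)] with y h1 h2 using hpos y h1 h2
      obtain ⟨z, hz1, hz2⟩ := mem_closure_iff_nhds.1 hxF.2 F this
      exact hz2 hz1
    · have : Fᶜ ∈ 𝓝 x := by
        filter_upwards [hb, hc.eventually (gt_mem_nhds h)] with y h1 h2 using hneg y h1 h2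
      obtain ⟨z, hz1, hz2⟩ := mem_closure_iff_nhds.1 hxF.1 _ this
      exact hz1 hz2
  have hgx0 : 0 < ‖g x‖ := by linarith
  set e := ‖g x‖⁻¹ • g x with he
  have hen : ‖e‖ = 1 := by
    rw [he, norm_smul, norm_inv, norm_norm, inv_mul_cancel₀ hgx0.ne']
  have hge : g x = ‖g x‖ • e := by rw [he, smul_inv_smul₀ hgx0.ne']
  have key : ∀ y, ‖y - x‖ ^ 2 < 2 * ρ * |inner ℝ (y - x) e| → y ∈ Metric.ball x₀ r ∧
      L * ‖y - x‖ ^ 2 < ‖g x‖ * |inner ℝ (y - x) e| := by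
    intro y hy
    have hin : |inner ℝ (y - x) e| ≤ ‖y - x‖ := by
      have := abs_real_inner_le_norm (y - x) e
      rwa [hen, mul_one] at this
    have hin0 : 0 < |inner ℝ (y - x) e| := by
      by_contra hcon
      have : |inner ℝ (y - x) e| = 0 := le_antisymm (not_lt.1 hcon) (abs_nonneg _)
      rw [this, mul_zero] at hy
      exact absurd hy (not_lt.2 (by positivity))
    have hyx : ‖y - x‖ < 2 * ρ := by nlinarith
    refine ⟨?_, ?_⟩
    · rw [Metric.mem_ball]
      have := dist_triangle y x x₀
      rw [dist_eq_norm y x] at this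
      have := Metric.mem_ball.1 hxs
      linarith
    · have hρL : 2 * ρ * (L + 1) ≤ m / 2 := by
        calc 2 * ρ * (L + 1) ≤ 2 * (m / (4 * (L + 1))) * (L + 1) := by
              gcongr; exact min_le_right _ _
          _ = m / 2 := by field_simp; norm_num
      calc L * ‖y - x‖ ^ 2 ≤ (L + 1) * ‖y - x‖ ^ 2 := by gcongr; linarith
        _ < (L + 1) * (2 * ρ * |inner ℝ (y - x) e|) := by gcongr
        _ = (2 * ρ * (L + 1)) * |inner ℝ (y - x) e| := by ring
        _ ≤ ‖g x‖ * |inner ℝ (y - x) e| := by gcongr; linarith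
  -- The outward normal is `-e`, since `F` lies on the side where `φ` is positive.
  refine ⟨-e, by rw [norm_neg, hen], ?_, ?_⟩
  · intro y hy
    rw [smul_neg, sub_neg_eq_add, mem_ball_add_smul_iff hρ hen] at hy
    have hnn : 0 ≤ inner ℝ (y - x) e := by
      by_contra hcon; nlinarith [sq_nonneg ‖y - x‖, not_le.1 hcon]
    obtain ⟨h1, h2⟩ := key y (by rwa [abs_of_nonneg hnn])
    refine hpos y h1 ?_
    have h3 := (abs_le.1 (abs_sub_sub_inner_le hφ hg hxr h1)).1
    rw [hge, real_inner_smul_left, real_inner_comm, hφx] at h3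
    rw [abs_of_nonneg hnn] at h2
    linarith
  · intro y hy
    rw [smul_neg, ← sub_eq_add_neg, mem_ball_sub_smul_iff hρ hen] at hy
    have hnn : inner ℝ (y - x) e ≤ 0 := by
      by_contra hcon; nlinarith [sq_nonneg ‖y - x‖, not_le.1 hcon]
    obtain ⟨h1, h2⟩ := key y (by rw [abs_of_nonpos hnn]; linarith)
    refine hneg y h1 ?_
    have h3 := (abs_le.1 (abs_sub_sub_inner_le hφ hg hxr h1)).2
    rw [hge, real_inner_smul_left, real_inner_comm, hφx] at h3
    rw [abs_of_nonpos hnn] at h2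
    linarith

/-- A set with compact `C^{1,1}` boundary satisfies a uniform two-sided ball condition. -/
theorem HasC11Boundary.exists_touchingBalls {n : ℕ} {F : Set (EuclideanSpace ℝ (Fin n))}
    (hF : HasC11Boundary F) (hc : IsCompact (frontier F)) :
    ∃ ρ : ℝ, 0 < ρ ∧ ∀ x ∈ frontier F, ∃ ν, HasTouchingBalls F ρ x ν := by
  suffices h : ∃ ρ : ℝ, 0 < ρ ∧ ∀ x ∈ frontier F ∩ frontier F, ∃ ν, HasTouchingBalls F ρ x ν by
    simpa using h
  refine hc.induction_on (p := fun S => ∃ ρ : ℝ, 0 < ρ ∧ ∀ x ∈ S ∩ frontier F,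
    ∃ ν, HasTouchingBalls F ρ x ν) ⟨1, one_pos, by simp⟩ ?_ ?_ ?_
  · rintro s t hst ⟨ρ, h1, h2⟩
    exact ⟨ρ, h1, fun x hx => h2 x ⟨hst hx.1, hx.2⟩⟩
  · rintro s t ⟨ρ, h1, h2⟩ ⟨ρ', h1', h2'⟩
    refine ⟨min ρ ρ', lt_min h1 h1', ?_⟩
    rintro x ⟨hx | hx, hxF⟩
    · obtain ⟨ν, hν⟩ := h2 x ⟨hx, hxF⟩
      exact ⟨ν, hν.mono (min_le_left _ _)⟩
    · obtain ⟨ν, hν⟩ := h2' x ⟨hx, hxF⟩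
      exact ⟨ν, hν.mono (min_le_right _ _)⟩
  · intro x hx
    obtain ⟨r, hr, φ, g, L, h1, h2, h3, h4, h5⟩ := hF x hx
    obtain ⟨ρ, hρ, U, hU, h⟩ := exists_touchingBalls_of_gradient hr h1 h2 h3 h4 h5
    exact ⟨U, mem_nhdsWithin_of_mem_nhds hU, ρ, hρ, h⟩

/-- At a boundary point an exterior ball of radius `r / 2` fills the fraction `2^(-d)` of the ball
of radius `r` and misses the frontier, so the frontier has no density-one points. This makes test
sets null measurable, which their definition does not require. -/
theorem volume_frontier_eq_zero_of_touchingBalls [FiniteDimensional ℝ V] [MeasureSpace V]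
    [BorelSpace V] [(volume : Measure V).IsAddHaarMeasure] {F : Set V} {ρ : ℝ} (hρ : 0 < ρ)
    (h : ∀ x ∈ frontier F, ∃ ν, HasTouchingBalls F ρ x ν) : volume (frontier F) = 0 := by
  by_contra hne
  have hae := (Besicovitch.ae_tendsto_measure_inter_div (volume : Measure V) (frontier F)).and
    (ae_restrict_mem isClosed_frontier.measurableSet)
  have : NeBot (ae ((volume : Measure V).restrict (frontier F))) := by
    rw [ae_neBot]; exact fun h0 => hne (Measure.restrict_eq_zero.1 h0)
  obtain ⟨x, hx, hxF⟩ := hae.exists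
  obtain ⟨ν, hν⟩ := h x hxF
  set c : ℝ≥0∞ := ENNReal.ofReal ((1 / 2) ^ Module.finrank ℝ V) with hc
  have hc0 : c ≠ 0 := by
    rw [hc, Ne, ENNReal.ofReal_eq_zero, not_le]; positivity
  have hbound : ∀ᶠ r in 𝓝[>] (0 : ℝ), volume (frontier F ∩ Metric.closedBall x r) /
      volume (Metric.closedBall x r) + c ≤ 1 := by
    filter_upwards [Ioo_mem_nhdsGT hρ] with r hr
    have hr0 : 0 < r := hr.1
    have hν' := hν.mono (by linarith [hr.2] : r / 2 ≤ ρ)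
    set B := Metric.ball (x + (r / 2) • ν) (r / 2) with hB
    have hBc : B ⊆ Metric.closedBall x r := by
      refine (Metric.ball_subset_ball' (ε₂ := r) ?_).trans Metric.ball_subset_closedBall
      rw [dist_eq_norm, add_sub_cancel_left, norm_smul, hν.1, Real.norm_of_nonneg (by linarith)]
      linarith
    have hdisj : Disjoint (frontier F) B := by
      refine Disjoint.mono_left frontier_subset_closure ?_
      refine Disjoint.closure_left (disjoint_left.2 fun y hy hyB => hν'.2.2 hyB hy)
        Metric.isOpen_ball
    have hvB : volume B = c * volume (Metric.closedBall x r) := by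
      rw [hB, Measure.addHaar_ball_of_pos _ _ (by linarith), Measure.addHaar_closedBall _ _ hr0.le,
        ← mul_assoc, hc, ← ENNReal.ofReal_mul (by positivity), ← mul_pow]
      congr 3; ring
    have hm0 : volume (Metric.closedBall x r) ≠ 0 := (Metric.measure_closedBall_pos _ _ hr0).ne'
    have hmt : volume (Metric.closedBall x r) ≠ ∞ := measure_closedBall_lt_top.ne
    have hle : volume (frontier F ∩ Metric.closedBall x r) + c * volume (Metric.closedBall x r) ≤
        volume (Metric.closedBall x r) := by
      rw [← hvB, ← measure_union (hdisj.mono_left inter_subset_left) measurableSet_ball]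
      exact measure_mono (union_subset inter_subset_right hBc)
    calc _ = (volume (frontier F ∩ Metric.closedBall x r) + c * volume (Metric.closedBall x r)) /
          volume (Metric.closedBall x r) := by
          rw [ENNReal.add_div, ENNReal.mul_div_cancel_right hm0 hmt]
      _ ≤ 1 := ENNReal.div_le_of_le_mul (by rwa [one_mul])
  have hlim := le_of_tendsto (hx.add_const c) hbound
  have : (1 : ℝ≥0∞) + c ≤ 1 + 0 := by simpa using hlim
  rw [ENNReal.add_le_add_iff_left ENNReal.one_ne_top] at this
  exact hc0 (le_antisymm this zero_le)

end TouchingBalls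

/-! ### The distance function and outer parallel sets -/

section Distance

variable {V : Type*} [NormedAddCommGroup V] [InnerProductSpace ℝ V] {E : Set V} {ρ : ℝ}

theorem mem_cthickening_iff_infDist_le (hE : E.Nonempty) {lam : ℝ} (hlam : 0 ≤ lam) {y : V} :
    y ∈ Metric.cthickening lam E ↔ Metric.infDist y E ≤ lam := by
  rw [Metric.mem_cthickening_iff, Metric.infDist,
    ENNReal.le_ofReal_iff_toReal_le (Metric.infEDist_ne_top hE) hlam]

theorem infDist_eq_of_mem_frontier_cthickening {lam : ℝ} (hlam : 0 ≤ lam) {x : V}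
    (hx : x ∈ frontier (Metric.cthickening lam E)) : Metric.infDist x E = lam := by
  have := Metric.frontier_cthickening_subset E hx
  rw [Metric.infDist, show Metric.infEDist x E = ENNReal.ofReal lam from this,
    ENNReal.toReal_ofReal hlam]

/-- With `HasTouchingBalls.infDist_le` this traps the distance to `E` between explicit distances to
the two touching balls. -/
theorem HasTouchingBalls.le_infDist {x ν : V} (h : HasTouchingBalls E ρ x ν) (hE : E.Nonempty)
    (y : V) : ρ - ‖y - (x + ρ • ν)‖ ≤ Metric.infDist y E := by
  refine (Metric.le_infDist hE).2 fun {e} he => ?_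
  have h1 : ρ ≤ dist e (x + ρ • ν) := by
    by_contra hlt
    exact h.2.2 (Metric.mem_ball.2 (not_le.1 hlt)) he
  have h2 := dist_triangle_left e (x + ρ • ν) y
  rw [dist_eq_norm y (x + ρ • ν)] at h2
  linarith

theorem HasTouchingBalls.infDist_le {x ν : V} (h : HasTouchingBalls E ρ x ν) (hE : IsClosed E)
    (hρ : 0 < ρ) {lam : ℝ} (hlam : 0 ≤ lam) {y : V} (hy : ‖y - (x - ρ • ν)‖ ≤ ρ + lam) :
    Metric.infDist y E ≤ lam := by
  set c := x - ρ • ν with hc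
  have hsub : Metric.closedBall c ρ ⊆ E := by
    rw [← closure_ball c hρ.ne']
    exact closure_minimal h.2.1 hE
  rcases le_or_gt ‖y - c‖ ρ with hle | hgt
  · rw [Metric.infDist_zero_of_mem (hsub (by rwa [Metric.mem_closedBall, dist_eq_norm]))]
    exact hlam
  · have h0 : 0 < ‖y - c‖ := hρ.trans hgt
    set e := c + (ρ / ‖y - c‖) • (y - c) with he
    have heE : e ∈ E := by
      refine hsub ?_
      rw [Metric.mem_closedBall, dist_eq_norm, he, add_sub_cancel_left, norm_smul, norm_div,
        norm_norm, div_mul_cancel₀ _ h0.ne', Real.norm_of_nonneg hρ.le]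
    refine (Metric.infDist_le_dist_of_mem heE).trans ?_
    rw [dist_eq_norm, he, show y - (c + (ρ / ‖y - c‖) • (y - c)) =
      (1 - ρ / ‖y - c‖) • (y - c) by rw [sub_smul, one_smul]; abel, norm_smul,
      Real.norm_of_nonneg (by rw [sub_nonneg, div_le_one h0]; exact hgt.le), sub_mul, one_mul,
      div_mul_cancel₀ _ h0.ne']
    linarith

/-- Disjoint balls touching at a point have opposite normals there. -/
theorem eq_of_disjoint_ball {x ν₁ ν₂ : V} {r₁ r₂ : ℝ} (h₁ : 0 < r₁) (h₂ : 0 < r₂)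
    (hν₁ : ‖ν₁‖ = 1) (hν₂ : ‖ν₂‖ = 1)
    (h : Disjoint (Metric.ball (x + r₁ • ν₁) r₁) (Metric.ball (x - r₂ • ν₂) r₂)) : ν₁ = ν₂ := by
  by_contra hne
  have hv : 0 < ‖ν₁ - ν₂‖ := norm_pos_iff.2 (sub_ne_zero.2 hne)
  set t := min r₁ r₂ / 2 with ht
  have ht0 : 0 < t := by have := lt_min h₁ h₂; positivity
  have ht1 : t < r₁ := by have := min_le_left r₁ r₂; have := lt_min h₁ h₂; linarith
  have ht2 : t < r₂ := by have := min_le_right r₁ r₂; have := lt_min h₁ h₂; linarith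
  have hsq : ‖ν₁ - ν₂‖ ^ 2 = 2 - 2 * inner ℝ ν₁ ν₂ := by
    rw [norm_sub_sq_real, hν₁, hν₂]; ring
  -- If the normals differed, this point would lie in both balls: membership reduces to `t < r₁` and
  -- `t < r₂`.
  refine disjoint_left.1 h (?_ : x + t • (ν₁ - ν₂) ∈ _) ?_
  · rw [mem_ball_add_smul_iff h₁ hν₁, add_sub_cancel_left, norm_smul, mul_pow,
      Real.norm_of_nonneg ht0.le, real_inner_smul_left, inner_sub_left,
      real_inner_self_eq_norm_sq, hν₁, real_inner_comm ν₁ ν₂]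
    have : 0 < (r₁ - t) * (t * ‖ν₁ - ν₂‖ ^ 2) := mul_pos (sub_pos.2 ht1) (by positivity)
    rw [show (1 : ℝ) ^ 2 - inner ℝ ν₁ ν₂ = ‖ν₁ - ν₂‖ ^ 2 / 2 by rw [hsq]; ring]
    linarith
  · rw [mem_ball_sub_smul_iff h₂ hν₂, add_sub_cancel_left, norm_smul, mul_pow,
      Real.norm_of_nonneg ht0.le, real_inner_smul_left, inner_sub_left,
      real_inner_self_eq_norm_sq, hν₂]
    have : 0 < (r₂ - t) * (t * ‖ν₁ - ν₂‖ ^ 2) := mul_pos (sub_pos.2 ht2) (by positivity)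
    rw [show inner ℝ ν₁ ν₂ - (1 : ℝ) ^ 2 = -(‖ν₁ - ν₂‖ ^ 2 / 2) by rw [hsq]; ring]
    linarith

/-- Points near `E` are of the form `x + d(p, E) ν` with `x ∈ ∂E` and `ν` the outward normal. -/
theorem exists_eq_add_infDist_smul [FiniteDimensional ℝ V] (hE : IsClosed E) (hne : E.Nonempty)
    (hρ : 0 < ρ) (hB : ∀ x ∈ frontier E, ∃ ν, HasTouchingBalls E ρ x ν) {p : V}
    (hp : 0 < Metric.infDist p E) :
    ∃ x ν, HasTouchingBalls E ρ x ν ∧ p = x + Metric.infDist p E • ν := by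
  have : ProperSpace V := FiniteDimensional.proper ℝ V
  obtain ⟨x, hxE, hx⟩ := hE.exists_infDist_eq_dist hne p
  set d := Metric.infDist p E with hd
  have hball : Metric.ball p d ⊆ Eᶜ := fun y hy hyE => by
    have := Metric.infDist_le_dist_of_mem (x := p) hyE
    rw [Metric.mem_ball, dist_comm] at hy
    linarith
  have hxF : x ∈ frontier E := by
    rw [frontier_eq_closure_inter_closure]
    refine ⟨subset_closure hxE, closure_mono hball ?_⟩
    rw [closure_ball _ hp.ne', Metric.mem_closedBall, dist_comm, hx]
  obtain ⟨ν, hν⟩ := hB x hxF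
  set e := d⁻¹ • (p - x) with he
  have hpe : p = x + d • e := by rw [he, smul_inv_smul₀ hp.ne']; abel
  have hen : ‖e‖ = 1 := by
    rw [he, norm_smul, ← dist_eq_norm, ← hx, norm_inv, Real.norm_of_nonneg hp.le,
      inv_mul_cancel₀ hp.ne']
  have heν : e = ν := by
    refine eq_of_disjoint_ball (x := x) hp hρ hen hν.1 ?_
    -- The ball about `p` misses `E`, and the interior ball at the nearest point `x` lies in `E`.
    rw [← hpe]
    exact disjoint_left.2 fun y h1 h2 => hball h1 (hν.2.1 h2)
  exact ⟨x, ν, hν, by rw [← heν]; exact hpe⟩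

/-- The outer parallel sets of a set with touching balls have touching balls. -/
theorem HasTouchingBalls.cthickening {x ν : V} (h : HasTouchingBalls E ρ x ν) (hE : IsClosed E)
    (hne : E.Nonempty) (hρ : 0 < ρ) {lam : ℝ} (hlam : 0 ≤ lam) (hlam' : lam ≤ ρ / 2) :
    HasTouchingBalls (Metric.cthickening lam E) (ρ / 2) (x + lam • ν) ν := by
  refine ⟨h.1, fun y hy => ?_, fun y hy => ?_⟩
  · rw [mem_cthickening_iff_infDist_le hne hlam]
    refine h.infDist_le hE hρ hlam ?_
    rw [Metric.mem_ball, dist_eq_norm] at hy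
    calc ‖y - (x - ρ • ν)‖ = ‖(y - (x + lam • ν - (ρ / 2) • ν)) + (ρ / 2 + lam) • ν‖ := by
          congr 1; module
      _ ≤ ‖y - (x + lam • ν - (ρ / 2) • ν)‖ + ‖(ρ / 2 + lam) • ν‖ := norm_add_le _ _
      _ ≤ ρ / 2 + (ρ / 2 + lam) := by
          rw [norm_smul, h.1, mul_one, Real.norm_of_nonneg (by linarith)]; linarith
      _ = ρ + lam := by ring
  · rw [mem_compl_iff, mem_cthickening_iff_infDist_le hne hlam, not_le]
    refine lt_of_lt_of_le ?_ (h.le_infDist hne y)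
    rw [Metric.mem_ball, dist_eq_norm] at hy
    have : ‖y - (x + ρ • ν)‖ < ρ - lam := by
      calc ‖y - (x + ρ • ν)‖ = ‖(y - (x + lam • ν + (ρ / 2) • ν)) - (ρ / 2 - lam) • ν‖ := by
            congr 1; module
        _ ≤ ‖y - (x + lam • ν + (ρ / 2) • ν)‖ + ‖(ρ / 2 - lam) • ν‖ := norm_sub_le _ _
        _ < ρ / 2 + (ρ / 2 - lam) := by
            rw [norm_smul, h.1, mul_one, Real.norm_of_nonneg (by linarith)]; linarith
        _ = ρ - lam := by ring
    linarith

/-- This is `‖w‖ ≤ (‖w‖² + a²) / (2a)` for `w = a ν + v`, with the square expanded. -/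
theorem norm_smul_add_le {ν v : V} {a : ℝ} (ha : 0 < a) (hν : ‖ν‖ = 1) :
    ‖a • ν + v‖ ≤ a + inner ℝ ν v + ‖v‖ ^ 2 / (2 * a) := by
  have h1 : ‖a • ν + v‖ ^ 2 = a ^ 2 + 2 * a * inner ℝ ν v + ‖v‖ ^ 2 := by
    rw [norm_add_sq_real, norm_smul, hν, real_inner_smul_left, Real.norm_of_nonneg ha.le]; ring
  have h2 : a + inner ℝ ν v + ‖v‖ ^ 2 / (2 * a) = (‖a • ν + v‖ ^ 2 + a ^ 2) / (2 * a) := by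
    rw [h1]; field_simp; ring
  rw [h2, le_div_iff₀ (by positivity)]
  nlinarith [sq_nonneg (‖a • ν + v‖ - a)]

/-- Second order expansion of the distance function. -/
theorem abs_infDist_sub_sub_inner_le {x ν p : V} {d C : ℝ} (h : HasTouchingBalls E ρ x ν)
    (hx : x ∈ E) (hd : 0 < d) (hdρ : d < ρ) (hp : p = x + d • ν)
    (hC : 1 / (2 * d) ≤ C) (hC' : 1 / (2 * (ρ - d)) ≤ C) (y : V) :
    |Metric.infDist y E - d - inner ℝ ν (y - p)| ≤ C * ‖y - p‖ ^ 2 := by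
  rw [abs_le]
  -- The lower bound compares with the centre of the exterior ball, at distance `ρ - d` from `p`;
  -- the upper one with the foot point `x`, at distance `d`.
  constructor
  · have h1 := h.le_infDist ⟨x, hx⟩ y
    have h2 := norm_smul_add_le (ν := -ν) (v := y - p) (sub_pos.2 hdρ) (by rw [norm_neg, h.1])
    rw [show (ρ - d) • -ν + (y - p) = y - (x + ρ • ν) by rw [hp]; module, inner_neg_left] at h2
    have h3 : ‖y - p‖ ^ 2 / (2 * (ρ - d)) ≤ C * ‖y - p‖ ^ 2 := by
      rw [div_eq_mul_one_div, mul_comm]; gcongr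
    linarith
  · have h1 := Metric.infDist_le_dist_of_mem (x := y) hx
    have h2 := norm_smul_add_le (ν := ν) (v := y - p) hd h.1
    rw [show d • ν + (y - p) = y - x by rw [hp]; module, ← dist_eq_norm] at h2
    have h3 : ‖y - p‖ ^ 2 / (2 * d) ≤ C * ‖y - p‖ ^ 2 := by
      rw [div_eq_mul_one_div, mul_comm]; gcongr
    linarith

end Distance

/-- The outer parallel sets of a set satisfying a uniform ball condition have `C^{1,1}`
boundary. -/
theorem hasC11Boundary_cthickening {n : ℕ} {E : Set (EuclideanSpace ℝ (Fin n))} {ρ : ℝ}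
    (hE : IsClosed E) (hne : E.Nonempty) (hρ : 0 < ρ)
    (hB : ∀ x ∈ frontier E, ∃ ν, HasTouchingBalls E ρ x ν) {lam : ℝ} (hlam : 0 < lam)
    (hlam' : lam < ρ / 2) : HasC11Boundary (Metric.cthickening lam E) := by
  intro x hx
  have hxd := infDist_eq_of_mem_frontier_cthickening hlam.le hx
  -- These bounds and `lam < ρ / 2` keep both `d` and `ρ - d` above `lam / 2`, so the Taylor
  -- constant `1 / lam` serves on the whole ball.
  have hd : ∀ p ∈ Metric.ball x (lam / 2),
      lam / 2 < Metric.infDist p E ∧ Metric.infDist p E < 3 * lam / 2 := by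
    intro p hp
    rw [Metric.mem_ball] at hp
    have h1 := Metric.infDist_le_infDist_add_dist (s := E) (x := x) (y := p)
    have h2 := Metric.infDist_le_infDist_add_dist (s := E) (x := p) (y := x)
    rw [dist_comm] at h1
    constructor <;> linarith
  have hex : ∀ p ∈ Metric.ball x (lam / 2), ∃ ν, ‖ν‖ = 1 ∧ ∀ y,
      |Metric.infDist y E - Metric.infDist p E - inner ℝ ν (y - p)| ≤ (1 / lam) * ‖y - p‖ ^ 2 := by
    intro p hp
    obtain ⟨h1, h2⟩ := hd p hp
    have h0 : 0 < Metric.infDist p E := by linarith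
    obtain ⟨z, ν, hν, hpz⟩ := exists_eq_add_infDist_smul hE hne hρ hB h0
    have hz : z ∈ E := hE.frontier_subset (hν.mem_frontier hρ)
    refine ⟨ν, hν.1, abs_infDist_sub_sub_inner_le hν hz h0 (by linarith) hpz ?_ ?_⟩
    · exact one_div_le_one_div_of_le hlam (by linarith)
    · exact one_div_le_one_div_of_le hlam (by linarith)
  choose! g hg1 hg2 using hex
  have hlin : ∀ p ∈ Metric.ball x (lam / 2), ∀ y,
      |(lam - Metric.infDist y E) - (lam - Metric.infDist p E) - inner ℝ (-g p) (y - p)| ≤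
        ((⟨1 / lam, by positivity⟩ : ℝ≥0) : ℝ) * ‖y - p‖ ^ 2 := by
    intro p hp y
    rw [inner_neg_left, ← abs_neg]
    refine le_trans (le_of_eq ?_) (hg2 p hp y)
    congr 1; ring
  refine ⟨lam / 2, by positivity, fun y => lam - Metric.infDist y E, fun p => -g p, _,
    fun p hp => hasGradientAt_of_abs_sub_sub_inner_le (hlin p hp),
    lipschitzOnWith_of_abs_sub_sub_inner_le hlin, fun p hp h0 => ?_, fun y _ hy => ?_,
    fun y _ hy => ?_⟩
  · have := hg1 p hp
    rw [neg_eq_zero.1 h0, norm_zero] at this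
    exact zero_ne_one this
  · rw [mem_cthickening_iff_infDist_le hne hlam.le]; linarith
  · rw [mem_cthickening_iff_infDist_le hne hlam.le]; linarith

/-! ### Reflection and the region between touching balls -/

section TangentRegion

variable {V : Type*} [NormedAddCommGroup V] [InnerProductSpace ℝ V] [FiniteDimensional ℝ V]
  [MeasureSpace V] [BorelSpace V] [(volume : Measure V).IsAddHaarMeasure] {k : V → ℝ≥0∞}

theorem kernelMeasure_apply_eq_lintegral_indicator (k : V → ℝ≥0∞) (x : V) {S : Set V}
    (hS : MeasurableSet S) :
    kernelMeasure k x S = ∫⁻ w, {w | x - w ∈ S}.indicator k w := by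
  rw [kernelMeasure_apply, ← lintegral_indicator hS, ← lintegral_sub_left_eq_self _ x]
  refine lintegral_congr fun w => ?_
  simp [indicator]

theorem kernelMeasure_reflection (heven : ∀ w, k (-w) = k w) (x : V) {S T : Set V}
    (hS : MeasurableSet S) (hT : MeasurableSet T) (hST : ∀ w, x + w ∈ S ↔ x - w ∈ T) :
    kernelMeasure k x S = kernelMeasure k x T := by
  rw [kernelMeasure_apply_eq_lintegral_indicator k x hS,
    kernelMeasure_apply_eq_lintegral_indicator k x hT, ← lintegral_sub_left_eq_self _ (0 : V)]
  refine lintegral_congr fun w => ?_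
  have h := hST w
  rw [zero_sub]
  by_cases hw : x - w ∈ T
  · simp [indicator, hw, h.2 hw, heven]
  · simp [indicator, hw, mt h.1 hw]

theorem kernelMeasure_truncation (k : V → ℝ≥0∞) (ε : ℝ) (x : V) (S : Set V) :
    kernelMeasure (truncation k ε) x S = kernelMeasure k x (S \ Metric.ball x ε) := by
  have : ∀ y, truncation k ε (x - y) = (Metric.ball x ε)ᶜ.indicator (fun y => k (x - y)) y := by
    intro y
    simp [truncation, indicator, dist_eq_norm, norm_sub_rev x y]
  simp_rw [kernelMeasure_apply, this]
  rw [lintegral_indicator measurableSet_ball.compl,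
    Measure.restrict_restrict measurableSet_ball.compl, inter_comm, Set.sdiff_eq]

theorem kernelMeasure_truncation_eq_add (k : V → ℝ≥0∞) {ε s : ℝ} (h : ε ≤ s) (x : V) (S : Set V) :
    kernelMeasure (truncation k ε) x S =
      kernelMeasure k x (S ∩ (Metric.ball x s \ Metric.ball x ε)) +
        kernelMeasure (truncation k s) x S := by
  rw [kernelMeasure_truncation, kernelMeasure_truncation,
    ← measure_inter_add_sdiff (S \ Metric.ball x ε) (measurableSet_ball (x := x) (ε := s))]
  congr 2
  · ext y; simp only [mem_inter_iff, Set.mem_sdiff]; tauto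
  · ext y
    have := @Metric.ball_subset_ball V _ x ε s h y
    simp only [Set.mem_sdiff]; tauto

/-- The region between the two balls of radius `ρ` touching at the origin with normal `ν`. -/
def tangentRegion (ρ r : ℝ) (ν : V) : Set V :=
  {w | ‖w‖ < r ∧ |inner ℝ w ν| ≤ 1 / (2 * ρ) * ‖w‖ ^ 2}

theorem measurableSet_tangentRegion (ρ r : ℝ) (ν : V) : MeasurableSet (tangentRegion ρ r ν) := by
  change MeasurableSet ({w : V | ‖w‖ < r} ∩ {w | |inner ℝ w ν| ≤ 1 / (2 * ρ) * ‖w‖ ^ 2})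
  refine (measurableSet_lt measurable_norm measurable_const).inter (measurableSet_le ?_ ?_)
  · exact (continuous_abs.comp (continuous_id.inner continuous_const)).measurable
  · exact ((continuous_norm.pow 2).const_mul _ : Continuous fun w : V => _).measurable

/-- The part of an annulus outside a set `S` with an interior touching ball is controlled by the
part inside of `S`. -/
theorem kernelMeasure_annulus_diff_le (heven : ∀ w, k (-w) = k w) {x ν : V} {ρ : ℝ} (hρ : 0 < ρ)
    (hν : ‖ν‖ = 1) {S : Set V} (hS : Metric.ball (x - ρ • ν) ρ ⊆ S) (ε s : ℝ) :
    kernelMeasure k x (Sᶜ ∩ (Metric.ball x s \ Metric.ball x ε)) ≤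
      kernelMeasure k x (S ∩ (Metric.ball x s \ Metric.ball x ε)) +
        ∫⁻ w in tangentRegion ρ s ν, k w := by
  set A := Metric.ball x s \ Metric.ball x ε with hA
  have hAm : MeasurableSet A := measurableSet_ball.diff measurableSet_ball
  set T : Set V := {y | y - x ∈ tangentRegion ρ s ν} with hTdef
  have hTm : MeasurableSet T := (measurable_id.sub measurable_const)
    (measurableSet_tangentRegion ρ s ν)
  have hT : kernelMeasure k x T = ∫⁻ w in tangentRegion ρ s ν, k w := by
    rw [kernelMeasure_apply_eq_lintegral_indicator k x hTm,
      ← lintegral_indicator (measurableSet_tangentRegion ρ s ν)]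
    refine lintegral_congr fun w => ?_
    simp [indicator, hTdef, tangentRegion]
  have hrefl : kernelMeasure k x (Metric.ball (x + ρ • ν) ρ ∩ A) =
      kernelMeasure k x (Metric.ball (x - ρ • ν) ρ ∩ A) := by
    refine kernelMeasure_reflection heven x (measurableSet_ball.inter hAm)
      (measurableSet_ball.inter hAm) fun w => ?_
    rw [mem_inter_iff, mem_inter_iff, mem_ball_add_smul_iff hρ hν, mem_ball_sub_smul_iff hρ hν]
    simp [hA, dist_eq_norm]
  -- `Sᶜ` avoids the interior ball, so its points lie in the mirror ball, whose mass was just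
  -- reflected into `S`, or between the two balls.
  have hsub : Sᶜ ∩ A ⊆ (Metric.ball (x + ρ • ν) ρ ∩ A) ∪ T := by
    rintro y ⟨hyS, hyA⟩
    by_cases hy : y ∈ Metric.ball (x + ρ • ν) ρ
    · exact Or.inl ⟨hy, hyA⟩
    · have h1 : y ∉ Metric.ball (x - ρ • ν) ρ := fun h => hyS (hS h)
      rw [mem_ball_add_smul_iff hρ hν, not_lt] at hy
      rw [mem_ball_sub_smul_iff hρ hν, not_lt] at h1
      refine Or.inr ⟨by rw [← dist_eq_norm]; exact hyA.1, ?_⟩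
      rw [div_mul_eq_mul_div, one_mul, le_div_iff₀ (by positivity)]
      rcases abs_cases (inner ℝ (y - x) ν) with ⟨h, _⟩ | ⟨h, _⟩ <;> rw [h] <;> linarith
  calc _ ≤ kernelMeasure k x (Metric.ball (x + ρ • ν) ρ ∩ A) + kernelMeasure k x T :=
        (measure_mono hsub).trans (measure_union_le _ _)
    _ ≤ _ := by
        rw [hT, hrefl]
        gcongr

end TangentRegion

/-! ### Existence and uniform approximation of the curvature -/

section Curvature

variable {n : ℕ} {K : EuclideanSpace ℝ (Fin n) → ℝ}

/-- The kernel with values in `[0, ∞]`. -/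
noncomputable def kernelDensity (K : EuclideanSpace ℝ (Fin n) → ℝ) :
    EuclideanSpace ℝ (Fin n) → ℝ≥0∞ :=
  fun w => ENNReal.ofReal (K w)

/-- Dividing the integrable product by its weight recovers `K` off the origin. The value at the
origin is restored separately, which also covers dimension zero. -/
theorem IsKernel.aemeasurable (hK : IsKernel K) : AEMeasurable K volume := by
  have h1 : AEMeasurable (fun x => (min 1 ‖x‖)⁻¹ * (min 1 ‖x‖ * K x)) volume :=
    (measurable_const.min measurable_norm).inv.aemeasurable.mul hK.integrable.aemeasurable
  have h2 : K = fun x => ({0}ᶜ : Set (EuclideanSpace ℝ (Fin n))).indicator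
      (fun x => (min 1 ‖x‖)⁻¹ * (min 1 ‖x‖ * K x)) x +
      ({0} : Set (EuclideanSpace ℝ (Fin n))).indicator (fun _ => K 0) x := by
    ext x
    by_cases hx : x = 0
    · simp [hx]
    · have : min 1 ‖x‖ ≠ 0 := (lt_min one_pos (norm_pos_iff.2 hx)).ne'
      simp [hx, inv_mul_cancel_left₀ this]
  rw [h2]
  exact (h1.indicator (measurableSet_singleton 0).compl).add
    (aemeasurable_const.indicator (measurableSet_singleton 0))

theorem IsKernel.aemeasurable_kernelDensity (hK : IsKernel K) :
    AEMeasurable (kernelDensity K) volume :=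
  hK.aemeasurable.ennreal_ofReal

theorem IsKernel.kernelDensity_neg (hK : IsKernel K) (w : EuclideanSpace ℝ (Fin n)) :
    kernelDensity K (-w) = kernelDensity K w := by
  rw [kernelDensity, kernelDensity, hK.symm]

theorem IsKernel.lintegral_min_mul_ne_top (hK : IsKernel K) :
    ∫⁻ w, ENNReal.ofReal (min 1 ‖w‖) * kernelDensity K w ≠ ∞ := by
  have : ∀ w, ENNReal.ofReal (min 1 ‖w‖) * kernelDensity K w =
      ENNReal.ofReal (min 1 ‖w‖ * K w) := fun w => by
    rw [kernelDensity, ENNReal.ofReal_mul (le_min zero_le_one (norm_nonneg _))]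
  simp_rw [this]
  exact hK.integrable.lintegral_lt_top.ne

theorem IsKernel.integrable_indicator (hK : IsKernel K) {ε : ℝ} (hε : 0 < ε) :
    Integrable ({w | ε ≤ ‖w‖}.indicator K) := by
  have hm : 0 < min 1 ε := lt_min one_pos hε
  refine (hK.integrable.norm.const_mul (min 1 ε)⁻¹).mono'
    (hK.aemeasurable.indicator (measurableSet_le_norm ε)).aestronglyMeasurable
    (ae_of_all _ fun w => ?_)
  by_cases hw : ε ≤ ‖w‖
  · rw [indicator_of_mem (show w ∈ {w | ε ≤ ‖w‖} from hw), norm_mul, ← mul_assoc,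
      Real.norm_of_nonneg (le_min zero_le_one (norm_nonneg w))]
    refine le_mul_of_one_le_left (norm_nonneg _) ?_
    rw [← div_eq_inv_mul, one_le_div hm]
    exact min_le_min_left _ hw
  · rw [indicator_of_notMem (show w ∉ {w | ε ≤ ‖w‖} from hw), norm_zero]
    positivity

theorem truncation_kernelDensity (K : EuclideanSpace ℝ (Fin n) → ℝ) (ε : ℝ) :
    truncation (kernelDensity K) ε = fun w => ENNReal.ofReal ({w | ε ≤ ‖w‖}.indicator K w) := by
  ext w
  by_cases hw : ε ≤ ‖w‖ <;> simp [truncation, kernelDensity, indicator, hw]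

theorem IsKernel.lintegral_truncation_ne_top (hK : IsKernel K) {ε : ℝ} (hε : 0 < ε) :
    ∫⁻ w, truncation (kernelDensity K) ε w ≠ ∞ := by
  rw [truncation_kernelDensity]
  exact (hK.integrable_indicator hε).lintegral_lt_top.ne

theorem IsKernel.kernelMeasure_truncation_ne_top (hK : IsKernel K) {ε : ℝ} (hε : 0 < ε)
    (x : EuclideanSpace ℝ (Fin n)) (S : Set (EuclideanSpace ℝ (Fin n))) :
    kernelMeasure (truncation (kernelDensity K) ε) x S ≠ ∞ := by
  refine ne_top_of_le_ne_top (hK.lintegral_truncation_ne_top hε) ?_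
  rw [← kernelMeasure_univ _ x]
  exact measure_mono (subset_univ _)

theorem IsKernel.truncatedCurvature_eq (hK : IsKernel K) {ε : ℝ} (hε : 0 < ε)
    {F : Set (EuclideanSpace ℝ (Fin n))} (hF : NullMeasurableSet F volume)
    (x : EuclideanSpace ℝ (Fin n)) :
    truncatedCurvature K F x ε =
      (kernelMeasure (truncation (kernelDensity K) ε) x Fᶜ).toReal -
        (kernelMeasure (truncation (kernelDensity K) ε) x F).toReal := by
  set f := {w | ε ≤ ‖w‖}.indicator K with hf
  have hfi : Integrable (fun y => f (x - y)) := (hK.integrable_indicator hε).comp_sub_left x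
  -- Truncation removes the origin, the only point where `K` may be negative.
  have hf0 : ∀ w, 0 ≤ f w := fun w => by
    refine indicator_nonneg (fun w hw => hK.nonneg w ?_) w
    rintro rfl
    rw [mem_ofPred_eq, norm_zero] at hw
    exact absurd hw (not_le.2 hε)
  have hS : ∀ S, (kernelMeasure (truncation (kernelDensity K) ε) x S).toReal =
      ∫ y in S, f (x - y) := by
    intro S
    rw [kernelMeasure_apply, truncation_kernelDensity,
      integral_eq_lintegral_of_nonneg_ae (ae_of_all _ fun y => hf0 _)
        hfi.aestronglyMeasurable.restrict]
  rw [hS, hS, truncatedCurvature, ← integral_indicator measurableSet_ball.compl]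
  have h1 : ∀ S : Set (EuclideanSpace ℝ (Fin n)), NullMeasurableSet S volume →
      ∫ y in S, f (x - y) = ∫ y, S.indicator (fun y => f (x - y)) y :=
    fun S hS => (integral_indicator₀ hS).symm
  rw [h1 _ hF.compl, h1 _ hF, ← integral_sub (hfi.indicator₀ hF.compl) (hfi.indicator₀ hF)]
  refine integral_congr_ae (ae_of_all _ fun y => ?_)
  by_cases hy : y ∈ F <;> by_cases hx : ε ≤ ‖y - x‖ <;>
    simp [hf, indicator, hy, hx, dist_eq_norm, norm_sub_rev x y]

/-- Truncated curvatures at points with an interior touching ball of fixed radius change little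
when the truncation is removed. -/
theorem exists_kernelMeasure_truncation_le (hK : IsKernel K) (hT : IsTangentiallyIntegrable K)
    {ρ η : ℝ} (hρ : 0 < ρ) (hη : 0 < η) :
    ∃ r : ℝ, 0 < r ∧ ∀ (x ν : EuclideanSpace ℝ (Fin n)) (S : Set (EuclideanSpace ℝ (Fin n))),
      ‖ν‖ = 1 → Metric.ball (x - ρ • ν) ρ ⊆ S → ∀ ε s : ℝ, ε ≤ s → s ≤ r →
      kernelMeasure (truncation (kernelDensity K) ε) x Sᶜ +
          kernelMeasure (truncation (kernelDensity K) s) x S ≤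
        kernelMeasure (truncation (kernelDensity K) ε) x S +
          kernelMeasure (truncation (kernelDensity K) s) x Sᶜ + ENNReal.ofReal η := by
  obtain ⟨r, hr, h⟩ := hT (1 / (2 * ρ)) (by positivity) η hη
  refine ⟨r, hr, fun x ν S hν hS ε s hεs hsr => ?_⟩
  have h1 := kernelMeasure_annulus_diff_le hK.kernelDensity_neg hρ hν hS ε s
  have h2 : ∫⁻ w in tangentRegion ρ s ν, kernelDensity K w ≤ ENNReal.ofReal η :=
    le_trans (lintegral_mono_set (t := {y | ‖y‖ < r ∧ |inner ℝ y ν| ≤ 1 / (2 * ρ) * ‖y‖ ^ 2})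
      fun w hw => ⟨hw.1.trans_le hsr, hw.2⟩) (h ν hν)
  rw [kernelMeasure_truncation_eq_add _ hεs x Sᶜ, kernelMeasure_truncation_eq_add _ hεs x S]
  calc _ ≤ kernelMeasure (kernelDensity K) x (S ∩ (Metric.ball x s \ Metric.ball x ε)) +
        ENNReal.ofReal η + kernelMeasure (truncation (kernelDensity K) s) x Sᶜ +
        kernelMeasure (truncation (kernelDensity K) s) x S := by
        gcongr
        exact h1.trans (by gcongr)
    _ = _ := by ring

/-- The one-sided estimate is applied to `F` with normal `ν` and to `Fᶜ` with normal `-ν`. The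
radius depends only on `ρ` and `η`. -/
theorem exists_abs_truncatedCurvature_sub_le (hK : IsKernel K) (hT : IsTangentiallyIntegrable K)
    {ρ η : ℝ} (hρ : 0 < ρ) (hη : 0 < η) :
    ∃ r : ℝ, 0 < r ∧ ∀ (x ν : EuclideanSpace ℝ (Fin n)) (F : Set (EuclideanSpace ℝ (Fin n))),
      NullMeasurableSet F volume → HasTouchingBalls F ρ x ν → ∀ ε s : ℝ, 0 < ε → ε ≤ s → s ≤ r →
      |truncatedCurvature K F x ε - truncatedCurvature K F x s| ≤ η := by
  obtain ⟨r, hr, h⟩ := exists_kernelMeasure_truncation_le hK hT hρ hη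
  refine ⟨r, hr, fun x ν F hF hB ε s hε hεs hsr => ?_⟩
  have h1 := h x ν F hB.1 hB.2.1 ε s hεs hsr
  have h2 := h x (-ν) Fᶜ hB.compl.1 hB.compl.2.1 ε s hεs hsr
  rw [compl_compl] at h2
  have hs : 0 < s := hε.trans_le hεs
  rw [hK.truncatedCurvature_eq hε hF, hK.truncatedCurvature_eq hs hF]
  have hfin := fun {t : ℝ} (ht : 0 < t) S => hK.kernelMeasure_truncation_ne_top ht x S
  have aux : ∀ {a b c d : ℝ≥0∞}, a ≠ ∞ → b ≠ ∞ → c ≠ ∞ → d ≠ ∞ →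
      a + b ≤ c + d + ENNReal.ofReal η → a.toReal + b.toReal ≤ c.toReal + d.toReal + η := by
    intro a b c d ha hb hc hd hle
    have := ENNReal.toReal_mono (by finiteness) hle
    rwa [ENNReal.toReal_add ha hb, ENNReal.toReal_add (by finiteness) (by finiteness),
      ENNReal.toReal_add hc hd, ENNReal.toReal_ofReal hη.le] at this
  have h1' := aux (hfin hε _) (hfin hs _) (hfin hε _) (hfin hs _) h1
  have h2' := aux (hfin hε _) (hfin hs _) (hfin hε _) (hfin hs _) h2
  rw [abs_le]
  constructor <;> linarith

theorem exists_hasKCurvature (hK : IsKernel K) (hT : IsTangentiallyIntegrable K) {ρ : ℝ}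
    (hρ : 0 < ρ) {x ν : EuclideanSpace ℝ (Fin n)} {F : Set (EuclideanSpace ℝ (Fin n))}
    (hF : NullMeasurableSet F volume) (hB : HasTouchingBalls F ρ x ν) :
    ∃ h, HasKCurvature K F x h := by
  refine cauchy_map_iff_exists_tendsto.1 (Metric.cauchy_iff.2 ⟨inferInstance, fun η hη => ?_⟩)
  obtain ⟨r, hr, h⟩ := exists_abs_truncatedCurvature_sub_le hK hT hρ (half_pos hη)
  refine ⟨_, image_mem_map (Ioo_mem_nhdsGT hr), ?_⟩
  rintro _ ⟨ε, hε, rfl⟩ _ ⟨s, hs, rfl⟩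
  rw [Real.dist_eq]
  rcases le_total ε s with hεs | hεs
  · exact (h x ν F hF hB ε s hε.1 hεs hs.2.le).trans_lt (half_lt_self hη)
  · rw [abs_sub_comm]
    exact (h x ν F hF hB s ε hs.1 hεs hε.2.le).trans_lt (half_lt_self hη)

/-- The truncated curvatures converge uniformly over all sets and points with touching balls of
fixed radius. -/
theorem exists_abs_sub_truncatedCurvature_le (hK : IsKernel K) (hT : IsTangentiallyIntegrable K)
    {ρ η : ℝ} (hρ : 0 < ρ) (hη : 0 < η) :
    ∃ r : ℝ, 0 < r ∧ ∀ (x ν : EuclideanSpace ℝ (Fin n)) (F : Set (EuclideanSpace ℝ (Fin n))),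
      NullMeasurableSet F volume → HasTouchingBalls F ρ x ν → ∀ h, HasKCurvature K F x h →
      ∀ s : ℝ, 0 < s → s ≤ r → |h - truncatedCurvature K F x s| ≤ η := by
  obtain ⟨r, hr, H⟩ := exists_abs_truncatedCurvature_sub_le hK hT hρ hη
  refine ⟨r, hr, fun x ν F hF hB h hh s hs hsr => ?_⟩
  refine le_of_tendsto (hh.sub_const _).abs ?_
  filter_upwards [Ioo_mem_nhdsGT hs] with ε hε
  exact H x ν F hF hB ε s hε.1 hε.2.le hsr

end Curvature

/-! ### Outward minimality and mean convexity -/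

section Minimizing

variable {n : ℕ} {K : EuclideanSpace ℝ (Fin n) → ℝ}

/-- The truncated curvature of `E ∪ B(c, |y - c|)` at a point `y ∉ E` close to `x` is controlled by
the curvature at `x` of a set `F ⊆ E`. -/
theorem exists_kernelMeasure_union_ball_le (hK : IsKernel K) (hT : IsTangentiallyIntegrable K)
    {F : Set (EuclideanSpace ℝ (Fin n))} (hF : NullMeasurableSet F volume) {ρ σ : ℝ} (hρ : 0 < ρ)
    (hσ : 0 < σ) {x ν : EuclideanSpace ℝ (Fin n)} (hB : HasTouchingBalls F ρ x ν) {h : ℝ}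
    (hh : HasKCurvature K F x h) {δ : ℝ} (hδ : 0 ≤ δ) (hlt : h < δ) :
    ∃ η s : ℝ, 0 < η ∧ 0 < s ∧ ∀ᶠ y in 𝓝 x, ∀ (c : EuclideanSpace ℝ (Fin n))
      (E : Set (EuclideanSpace ℝ (Fin n))), F ⊆ E → σ ≤ dist y c → ∀ ε, 0 < ε → ε < s →
      kernelMeasure (truncation (kernelDensity K) ε) y (E ∪ Metric.ball c (dist y c))ᶜ +
          ENNReal.ofReal η ≤
        kernelMeasure (truncation (kernelDensity K) ε) y (E ∪ Metric.ball c (dist y c)) +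
          ENNReal.ofReal δ := by
  -- Of the five shares, one pays for truncation at `x`, one for truncation at `y`, two for moving
  -- the centre from `x` to `y`, and one is the gain.
  set η := (δ - h) / 5 with hηdef
  have hη : 0 < η := by rw [hηdef]; linarith
  obtain ⟨r₁, hr₁, H₁⟩ := exists_abs_sub_truncatedCurvature_le hK hT hρ hη
  obtain ⟨r₂, hr₂, H₂⟩ := exists_kernelMeasure_truncation_le hK hT hσ hη
  set s := min r₁ r₂ with hsdef
  have hs : 0 < s := lt_min hr₁ hr₂
  have hcurv := (abs_le.1 (H₁ x ν F hF hB h hh s hs (min_le_left _ _))).1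
  rw [hK.truncatedCurvature_eq hs hF] at hcurv
  refine ⟨η, s, hη, hs, ?_⟩
  filter_upwards [eventually_kernelMeasure_le_add (hK.integrable_indicator hs) x hη]
    with y hy c E hFE hσy ε hε hεs
  rw [← truncation_kernelDensity] at hy
  set S := E ∪ Metric.ball c (dist y c)
  have hd : 0 < ‖y - c‖ := by rw [← dist_eq_norm]; linarith
  have hball : Metric.ball (y - σ • (‖y - c‖⁻¹ • (y - c))) σ ⊆ S := by
    refine (Metric.ball_subset_ball' ?_).trans subset_union_right
    rw [dist_eq_norm, show y - σ • (‖y - c‖⁻¹ • (y - c)) - c =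
      (1 - σ * ‖y - c‖⁻¹) • (y - c) by rw [smul_smul, sub_smul, one_smul]; abel, norm_smul,
      Real.norm_of_nonneg, sub_mul, mul_assoc, inv_mul_cancel₀ hd.ne', dist_eq_norm]
    · linarith
    · rw [← div_eq_mul_inv, sub_nonneg, div_le_one hd, ← dist_eq_norm]; exact hσy
  have hnear := H₂ y (‖y - c‖⁻¹ • (y - c)) S
    (by rw [norm_smul, norm_inv, norm_norm, inv_mul_cancel₀ hd.ne']) hball ε s hεs.le
    (min_le_right _ _)
  have hFS : F ⊆ S := hFE.trans subset_union_left
  set κε := kernelMeasure (truncation (kernelDensity K) ε) y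
  have hε' : ∀ S, κε S ≠ ∞ := hK.kernelMeasure_truncation_ne_top hε y
  have hs' : ∀ z S, kernelMeasure (truncation (kernelDensity K) s) z S ≠ ∞ :=
    hK.kernelMeasure_truncation_ne_top hs
  -- The total mass is independent of the centre, so what `Fᶜ` gains in passing from `x` to `y` is
  -- exactly what `F` loses.
  have hmass : kernelMeasure (truncation (kernelDensity K) s) y F +
      kernelMeasure (truncation (kernelDensity K) s) y Fᶜ =
      kernelMeasure (truncation (kernelDensity K) s) x F +
      kernelMeasure (truncation (kernelDensity K) s) x Fᶜ := by
    rw [measure_add_measure_compl₀ (hF.mono_ac (kernelMeasure_absolutelyContinuous _ _)),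
      measure_add_measure_compl₀ (hF.mono_ac (kernelMeasure_absolutelyContinuous _ _)),
      kernelMeasure_univ, kernelMeasure_univ]
  have hadd : ∀ {a b : ℝ≥0∞}, a ≠ ∞ → b ≠ ∞ → a + b ≠ ∞ :=
    fun ha hb => ENNReal.add_ne_top.2 ⟨ha, hb⟩
  have hη' : ENNReal.ofReal η ≠ ∞ := ENNReal.ofReal_ne_top
  have hδ' : ENNReal.ofReal δ ≠ ∞ := ENNReal.ofReal_ne_top
  have e1 := ENNReal.toReal_mono (hadd (hadd (hε' _) (hs' _ _)) hη') hnear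
  rw [ENNReal.toReal_add (hε' _) (hs' _ _), ENNReal.toReal_add (hadd (hε' _) (hs' _ _)) hη',
    ENNReal.toReal_add (hε' _) (hs' _ _), ENNReal.toReal_ofReal hη.le] at e1
  have e2 := ENNReal.toReal_mono (hadd (hs' _ _) hη') (hy Fᶜ)
  rw [ENNReal.toReal_add (hs' _ _) hη', ENNReal.toReal_ofReal hη.le] at e2
  have e3 := congrArg ENNReal.toReal hmass
  rw [ENNReal.toReal_add (hs' _ _) (hs' _ _), ENNReal.toReal_add (hs' _ _) (hs' _ _)] at e3
  have e4 := ENNReal.toReal_mono (hs' y S) (measure_mono hFS)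
  have e5 := ENNReal.toReal_mono (hs' y Fᶜ) (measure_mono (compl_subset_compl.2 hFS))
  rw [← ENNReal.toReal_le_toReal (hadd (hε' _) hη') (hadd (hε' _) hδ'),
    ENNReal.toReal_add (hε' _) hη', ENNReal.toReal_add (hε' _) hδ',
    ENNReal.toReal_ofReal hη.le, ENNReal.toReal_ofReal hδ]
  linarith

/-- Outward minimizing sets are mean convex in the viscosity sense. -/
theorem viscosityCurvatureGE_of_perimeter_add_le (hK : IsKernel K)
    (hT : IsTangentiallyIntegrable K) {E Ω : Set (EuclideanSpace ℝ (Fin n))}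
    (hE : NullMeasurableSet E volume) (hΩ : IsOpen Ω) (hEΩ : CompactlyIn E Ω)
    (hdens : ∀ x ∈ frontier E, ∀ r : ℝ, 0 < r → 0 < volume (Metric.ball x r \ E))
    {δ : ℝ} (hδ : 0 ≤ δ)
    (hmin : ∀ F : Set (EuclideanSpace ℝ (Fin n)), NullMeasurableSet F volume → E ⊆ F →
      CompactlyIn (F \ E) Ω →
        perimeter K E Ω + ENNReal.ofReal δ * volume (F \ E) ≤ perimeter K F Ω)
    {x : EuclideanSpace ℝ (Fin n)} (hx : x ∈ frontier E) : ViscosityCurvatureGE K E x δ := by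
  intro F hFE hFc hF11 hxF
  obtain ⟨ρ, hρ, hB⟩ := hF11.exists_touchingBalls hFc
  obtain ⟨ν, hν⟩ := hB x hxF
  have hF : NullMeasurableSet F volume :=
    nullMeasurableSet_of_null_frontier (volume_frontier_eq_zero_of_touchingBalls hρ hB)
  obtain ⟨h, hh⟩ := exists_hasKCurvature hK hT hρ hF hν
  refine ⟨h, hh, le_of_not_gt fun hlt => ?_⟩
  have hk := hK.aemeasurable_kernelDensity
  have heven := hK.kernelDensity_neg
  have hEsub : E ⊆ Ω := subset_closure.trans hEΩ.2
  have : Nontrivial (EuclideanSpace ℝ (Fin n)) :=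
    ⟨ν, 0, fun h0 => by have := hν.1; rw [h0, norm_zero] at this; exact zero_ne_one this⟩
  -- Minimality against a finite-perimeter competitor built from balls makes the perimeter of `E`
  -- finite, so it can be subtracted.
  have hper : interaction (kernelDensity K) E Eᶜ ≠ ∞ := by
    obtain ⟨F', hF'm, hEF', hF'c, hF'Ω, hF'fin⟩ := exists_superset_interaction_compl_ne_top hk
      hK.lintegral_min_mul_ne_top hEΩ.1 hΩ hEΩ.2
    have h1 := hmin F' hF'm.nullMeasurableSet (subset_closure.trans hEF')
      ⟨hF'c.of_isClosed_subset isClosed_closure (closure_mono Set.sdiff_subset),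
        (closure_mono Set.sdiff_subset).trans hF'Ω⟩
    rw [perimeter_eq_interaction hk hE hΩ hEsub, perimeter_eq_interaction hk
      hF'm.nullMeasurableSet hΩ (subset_closure.trans hF'Ω)] at h1
    exact ne_top_of_le_ne_top hF'fin (le_self_add.trans h1)
  -- Halving the radius makes the ball touch the sphere of radius `ρ` only at `x`, so that a slight
  -- enlargement leaves `E` only near `x`.
  set σ := ρ / 2 with hσdef
  have hσ : 0 < σ := by positivity
  set c := x - σ • ν with hc
  obtain ⟨η, s, hη, hs, hev⟩ := exists_kernelMeasure_union_ball_le hK hT hF hρ hσ hν hh hδ hlt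
  obtain ⟨r, hr, hrsub⟩ := Metric.nhds_basis_closedBall.mem_iff.1
    (hev.and (hΩ.mem_nhds (hEΩ.2 (frontier_subset_closure hx))))
  -- For `y ∈ G` the ball conditions give `‖y - x‖² / 2 < 2σt + t² ≤ 3σt`, whence `‖y - x‖² < 6σt ≤
  -- r²`.
  set t := min σ (r ^ 2 / (6 * σ)) with htdef
  have ht : 0 < t := lt_min hσ (by positivity)
  set A := Metric.ball c (σ + t) with hA
  set G := A \ E with hG
  set Q := (E ∪ A)ᶜ with hQ
  have hAm : NullMeasurableSet A volume := measurableSet_ball.nullMeasurableSet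
  have hGm : NullMeasurableSet G volume := hAm.diff hE
  have hQm : NullMeasurableSet Q volume := (hE.union hAm).compl
  have hGfin : volume G ≠ ∞ := measure_ne_top_of_subset Set.sdiff_subset measure_ball_lt_top.ne
  have hGσ : ∀ y ∈ G, σ ≤ dist y c := by
    intro y hy
    by_contra hcon
    exact hy.2 (hFE ((hν.mono (by linarith : σ ≤ ρ)).2.1 (Metric.mem_ball.2 (not_le.1 hcon))))
  have hGr : G ⊆ Metric.closedBall x r := by
    intro y hy
    have h1 : y ∉ Metric.ball (x - ρ • ν) ρ := fun h => hy.2 (hFE (hν.2.1 h))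
    rw [mem_ball_sub_smul_iff hρ hν.1, not_lt] at h1
    have h2 : ‖y - c‖ ^ 2 < (σ + t) ^ 2 := by
      have := Metric.mem_ball.1 hy.1
      rw [dist_eq_norm] at this
      gcongr
    have h3 : ‖y - c‖ ^ 2 = ‖y - x‖ ^ 2 + 2 * σ * inner ℝ (y - x) ν + σ ^ 2 := by
      rw [hc, show y - (x - σ • ν) = (y - x) + σ • ν by abel, norm_add_sq_real, norm_smul, hν.1,
        inner_smul_right, Real.norm_of_nonneg hσ.le]
      ring
    have h4 : t * (6 * σ) ≤ r ^ 2 := (le_div_iff₀ (by positivity)).1 (min_le_right _ _)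
    have h5 : t ≤ σ := min_le_left _ _
    have h6 : ρ = 2 * σ := by rw [hσdef]; ring
    rw [h6] at h1
    rw [Metric.mem_closedBall, dist_eq_norm, ← sq_le_sq₀ (norm_nonneg _) hr.le]
    nlinarith
  have hGpos : 0 < volume G := by
    refine (hdens x hx t ht).trans_le (measure_mono (sdiff_subset_sdiff_left ?_))
    refine Metric.ball_subset_ball' ?_
    rw [dist_eq_norm, hc, sub_sub_cancel, norm_smul, hν.1, mul_one, Real.norm_of_nonneg hσ.le]
    linarith
  have hGQ : Disjoint G Q := disjoint_left.2 fun y h1 h2 => h2 (Or.inr h1.1)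
  have hEG : Disjoint E G := disjoint_left.2 fun y h1 h2 => h2.2 h1
  have hEA : E ∪ A = E ∪ G := by rw [hG, union_sdiff_self]
  have hEc : Eᶜ = Q ∪ G := by
    ext y; simp only [hQ, hG, mem_compl_iff, mem_union, Set.mem_sdiff]; tauto
  have hcal : interaction (kernelDensity K) G Q + ENNReal.ofReal η * volume G ≤
      interaction (kernelDensity K) G E + ENNReal.ofReal δ * volume G := by
    refine interaction_add_le_of_truncation hk hGm hQm hGQ hs fun ε hε hεs => ?_
    refine (interaction_add_le_of_levelSets (aemeasurable_truncation hk ε)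
      (truncation_neg heven ε) (hK.lintegral_truncation_ne_top hε)
      (u := fun y => dist y c) (measurable_id.dist measurable_const) hGm hGfin hGQ.symm
      (P := E) (b := ENNReal.ofReal δ) fun y hy => ?_).trans
      (add_le_add_left (interaction_mono_kernel (truncation_le _ _) _ _) _)
    have hyA : dist y c < σ + t := hy.1
    have h1 : Q ∪ G ∩ {z | dist y c ≤ dist z c} = (E ∪ Metric.ball c (dist y c))ᶜ := by
      ext z
      simp only [hQ, hG, hA, mem_compl_iff, mem_union, mem_inter_iff, Set.mem_sdiff,
        Metric.mem_ball, mem_ofPred_eq, not_or, not_lt]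
      constructor
      · rintro (⟨h1, h2⟩ | ⟨⟨h1, h2⟩, h3⟩)
        · exact ⟨h1, by linarith⟩
        · exact ⟨h2, h3⟩
      · rintro ⟨h1, h2⟩
        rcases lt_or_ge (dist z c) (σ + t) with h3 | h3
        · exact Or.inr ⟨⟨h3, h1⟩, h2⟩
        · exact Or.inl ⟨h1, h3⟩
    have h2 : E ∪ G ∩ {z | dist z c < dist y c} = E ∪ Metric.ball c (dist y c) := by
      ext z
      simp only [hG, hA, mem_union, mem_inter_iff, Set.mem_sdiff, Metric.mem_ball, mem_ofPred_eq]
      constructor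
      · tauto
      · rintro (h1 | h1)
        · exact Or.inl h1
        · by_cases hz : z ∈ E
          · exact Or.inl hz
          · exact Or.inr ⟨⟨h1.trans hyA, hz⟩, h1⟩
    rw [h1, h2]
    exact (hrsub (hGr hy)).1 c E hFE (hGσ y hy) ε hε hεs
  have hEAdiff : (E ∪ A) \ E = G := by rw [hG, union_sdiff_left]
  have hGcl : closure G ⊆ Metric.closedBall x r := closure_minimal hGr Metric.isClosed_closedBall
  have hm := hmin (E ∪ A) (hE.union hAm) subset_union_left (by
    rw [hEAdiff]
    exact ⟨(isCompact_closedBall x r).of_isClosed_subset isClosed_closure hGcl,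
      fun y hy => (hrsub (hGcl hy)).2⟩)
  have hEAΩ : E ∪ A ⊆ Ω := by
    rw [hEA]
    exact union_subset hEsub fun y hy => (hrsub (hGr hy)).2
  rw [perimeter_eq_interaction hk hE hΩ hEsub, perimeter_eq_interaction hk (hE.union hAm) hΩ hEAΩ,
    hEAdiff] at hm
  change interaction (kernelDensity K) E Eᶜ + ENNReal.ofReal δ * volume G ≤
    interaction (kernelDensity K) (E ∪ A) Q at hm
  rw [hEc, interaction_union_right hk _ hGQ.symm hGm, hEA,
    interaction_union_left hk heven _ hEG hGm, add_assoc] at hm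
  rw [hEc, interaction_union_right hk _ hGQ.symm hGm, ENNReal.add_ne_top] at hper
  rw [ENNReal.add_le_add_iff_left hper.1, interaction_comm hk heven E G] at hm
  rw [interaction_comm hk heven E G] at hper
  have hfin : interaction (kernelDensity K) G Q ≠ ∞ :=
    ne_top_of_le_ne_top (by finiteness [hper.2]) (le_self_add.trans hcal)
  have hle := hcal.trans hm
  have hzero : ENNReal.ofReal η * volume G ≤ 0 := by
    rw [← ENNReal.add_le_add_iff_left hfin, add_zero]; exact hle
  exact absurd hzero (not_le.2 (ENNReal.mul_pos (ENNReal.ofReal_pos.2 hη).ne' hGpos.ne'))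

/-- The calibration inequality on the outer parallel sets of a strongly mean convex set. -/
theorem kernelMeasure_cthickening_add_le (hK : IsKernel K)
    {E : Set (EuclideanSpace ℝ (Fin n))} (hEb : Bornology.IsBounded E) (hEc : IsClosed E)
    (hne : E.Nonempty) {ρ δ ξ η r : ℝ} (hρ : 0 < ρ) (hδ : 0 ≤ δ) (hη : 0 < η)
    (hB : ∀ x ∈ frontier E, ∃ ν, HasTouchingBalls E ρ x ν)
    (hconv : ∀ lam ∈ Icc (0 : ℝ) ξ, ∀ x ∈ frontier (Metric.cthickening lam E),
      ViscosityCurvatureGE K (Metric.cthickening lam E) x δ)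
    (hr : ∀ (x ν : EuclideanSpace ℝ (Fin n)) (F : Set (EuclideanSpace ℝ (Fin n))),
      NullMeasurableSet F volume → HasTouchingBalls F (ρ / 2) x ν → ∀ h, HasKCurvature K F x h →
      ∀ s : ℝ, 0 < s → s ≤ r → |h - truncatedCurvature K F x s| ≤ η)
    {y : EuclideanSpace ℝ (Fin n)} (hy0 : 0 < Metric.infDist y E)
    (hyξ : Metric.infDist y E < min ξ (ρ / 2)) {ε : ℝ} (hε : 0 < ε) (hεr : ε < r) :
    kernelMeasure (truncation (kernelDensity K) ε) y {z | Metric.infDist z E ≤ Metric.infDist y E} +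
        ENNReal.ofReal δ ≤
      kernelMeasure (truncation (kernelDensity K) ε) y
        {z | Metric.infDist y E < Metric.infDist z E} + ENNReal.ofReal η := by
  set lam := Metric.infDist y E with hlam
  have hlξ : lam < ξ := hyξ.trans_le (min_le_left _ _)
  have hlρ : lam < ρ / 2 := hyξ.trans_le (min_le_right _ _)
  set D := Metric.cthickening lam E with hD
  obtain ⟨z, ν, hν, hyz⟩ := exists_eq_add_infDist_smul hEc hne hρ hB hy0
  have hDB : HasTouchingBalls D (ρ / 2) y ν := by
    have := hν.cthickening hEc hne hρ hy0.le hlρ.le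
    rwa [← hyz] at this
  have hyD : y ∈ frontier D := hDB.mem_frontier (by positivity)
  have hDm : NullMeasurableSet D volume :=
    Metric.isClosed_cthickening.measurableSet.nullMeasurableSet
  have hDc : IsCompact (frontier D) :=
    (Metric.isCompact_of_isClosed_isBounded Metric.isClosed_cthickening
      hEb.cthickening).of_isClosed_subset isClosed_frontier
      Metric.isClosed_cthickening.frontier_subset
  -- The parallel set is its own test set.
  obtain ⟨h, hh, hδh⟩ := hconv lam ⟨hy0.le, hlξ.le⟩ y hyD D subset_rfl hDc
    (hasC11Boundary_cthickening hEc hne hρ hB hy0 hlρ) hyD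
  have hcurv := (abs_le.1 (hr y ν D hDm hDB h hh ε hε hεr.le)).2
  rw [hK.truncatedCurvature_eq hε hDm] at hcurv
  have hDeq : D = {z | Metric.infDist z E ≤ lam} := by
    ext z; exact mem_cthickening_iff_infDist_le hne hy0.le
  have hDceq : Dᶜ = {z | lam < Metric.infDist z E} := by
    ext z; rw [hDeq, mem_compl_iff, mem_ofPred_eq, not_le]; rfl
  rw [← hDeq, ← hDceq]
  have hfin := hK.kernelMeasure_truncation_ne_top hε y
  rw [← ENNReal.toReal_le_toReal (ENNReal.add_ne_top.2 ⟨hfin _, ENNReal.ofReal_ne_top⟩)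
    (ENNReal.add_ne_top.2 ⟨hfin _, ENNReal.ofReal_ne_top⟩), ENNReal.toReal_add (hfin _)
    ENNReal.ofReal_ne_top, ENNReal.toReal_add (hfin _) ENNReal.ofReal_ne_top,
    ENNReal.toReal_ofReal hδ, ENNReal.toReal_ofReal hη.le]
  linarith

/-- Strongly mean convex sets are outward minimizing in a neighbourhood. -/
theorem exists_forall_perimeter_add_le (hK : IsKernel K) (hT : IsTangentiallyIntegrable K)
    {E : Set (EuclideanSpace ℝ (Fin n))} {δ : ℝ} (hEb : Bornology.IsBounded E)
    (hE11 : HasC11Boundary E) (hE : IsStronglyKMeanConvex K δ E) :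
    ∃ Ω : Set (EuclideanSpace ℝ (Fin n)), IsOpen Ω ∧ CompactlyIn E Ω ∧
      ∀ F : Set (EuclideanSpace ℝ (Fin n)), NullMeasurableSet F volume → E ⊆ F →
        CompactlyIn (F \ E) Ω →
        perimeter K E Ω + ENNReal.ofReal δ * volume (F \ E) ≤ perimeter K F Ω := by
  obtain ⟨hEc, hδ, ξ, hξ, hconv⟩ := hE
  rcases E.eq_empty_or_nonempty with rfl | hne
  · refine ⟨∅, isOpen_empty, ⟨by simp, by simp⟩, fun F _ _ hF => ?_⟩
    rw [Set.sdiff_empty] at hF ⊢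
    have : F = ∅ := subset_empty_iff.1 (subset_closure.trans hF.2)
    simp [this]
  have hEcomp : IsCompact E := Metric.isCompact_of_isClosed_isBounded hEc hEb
  obtain ⟨ρ, hρ, hB⟩ := hE11.exists_touchingBalls
    (hEcomp.of_isClosed_subset isClosed_frontier hEc.frontier_subset)
  -- Below `ξ` the parallel sets are mean convex, and below `ρ / 2` they keep touching balls of
  -- radius `ρ / 2`.
  set Ω := {y | Metric.infDist y E < min ξ (ρ / 2)} with hΩdef
  have hΩ : IsOpen Ω := isOpen_lt (Metric.continuous_infDist_pt E) continuous_const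
  have hEΩ : E ⊆ Ω := fun y hy => by
    rw [hΩdef, mem_ofPred_eq, Metric.infDist_zero_of_mem hy]
    exact lt_min hξ (by positivity)
  refine ⟨Ω, hΩ, by rw [CompactlyIn, hEc.closure_eq]; exact ⟨hEcomp, hEΩ⟩, fun F hF hEF hFΩ => ?_⟩
  have hk := hK.aemeasurable_kernelDensity
  have heven := hK.kernelDensity_neg
  have hEm : NullMeasurableSet E volume := hEc.measurableSet.nullMeasurableSet
  set G := F \ E with hG
  have hGm : NullMeasurableSet G volume := hF.diff hEm
  have hGfin : volume G ≠ ∞ := measure_ne_top_of_subset subset_closure hFΩ.1.measure_lt_top.ne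
  have hGΩ : G ⊆ Ω := subset_closure.trans hFΩ.2
  have hFeq : F = E ∪ G := (union_sdiff_cancel hEF).symm
  have hEG : Disjoint E G := disjoint_sdiff_right
  have hFG : Disjoint Fᶜ G := disjoint_left.2 fun y h1 h2 => h1 h2.1
  have hEceq : Eᶜ = Fᶜ ∪ G := by
    ext y; have := @hEF y; simp only [hG, mem_compl_iff, mem_union, Set.mem_sdiff]; tauto
  have hcal : ∀ η : ℝ, 0 < η → interaction (kernelDensity K) G E +
      ENNReal.ofReal δ * volume G ≤
      interaction (kernelDensity K) G Fᶜ + ENNReal.ofReal η * volume G := by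
    intro η hη
    obtain ⟨r, hr, H⟩ := exists_abs_sub_truncatedCurvature_le hK hT (half_pos hρ) hη
    refine interaction_add_le_of_truncation hk hGm hEm hEG.symm hr fun ε hε hεr => ?_
    refine (interaction_add_le_of_levelSets (aemeasurable_truncation hk ε)
      (truncation_neg heven ε) (hK.lintegral_truncation_ne_top hε)
      (u := fun y => -Metric.infDist y E) (Metric.continuous_infDist_pt E).measurable.neg hGm
      hGfin hEG (P := Fᶜ) (b := ENNReal.ofReal η) fun y hy => ?_).trans
      (add_le_add_left (interaction_mono_kernel (truncation_le _ _) _ _) _)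
    have hy0 : 0 < Metric.infDist y E := (hEc.notMem_iff_infDist_pos hne).1 hy.2
    -- Only inclusions hold, since `G` need not fill the parallel sets; both go in the favourable
    -- direction.
    refine le_trans (add_le_add_left (measure_mono ?_) _)
      ((kernelMeasure_cthickening_add_le hK hEb hEc hne hρ hδ hη hB hconv H hy0 (hGΩ hy) hε
        hεr).trans (add_le_add_left (measure_mono ?_) _))
    · rintro z (hz | ⟨_, hz⟩)
      · rw [mem_ofPred_eq, Metric.infDist_zero_of_mem hz]; exact hy0.le
      · rw [mem_ofPred_eq, neg_le_neg_iff] at hz; exact hz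
    · intro z hz
      by_cases hzF : z ∈ F
      · rw [mem_ofPred_eq] at hz
        refine Or.inr ⟨⟨hzF, fun hzE => ?_⟩, by rw [mem_ofPred_eq]; exact neg_lt_neg hz⟩
        rw [Metric.infDist_zero_of_mem hzE] at hz
        exact absurd hz (not_lt.2 hy0.le)
      · exact Or.inl hzF
  have hmain : interaction (kernelDensity K) G E + ENNReal.ofReal δ * volume G ≤
      interaction (kernelDensity K) G Fᶜ := by
    have hlim : Tendsto (fun η : ℝ => interaction (kernelDensity K) G Fᶜ +
        ENNReal.ofReal η * volume G) (𝓝[>] 0) (𝓝 (interaction (kernelDensity K) G Fᶜ +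
          ENNReal.ofReal 0 * volume G)) := by
      refine tendsto_const_nhds.add (ENNReal.Tendsto.mul_const ?_ (Or.inr hGfin))
      exact (ENNReal.tendsto_ofReal tendsto_id).mono_left nhdsWithin_le_nhds
    rw [ENNReal.ofReal_zero, zero_mul, add_zero] at hlim
    refine ge_of_tendsto hlim ?_
    filter_upwards [self_mem_nhdsWithin] with η hη using hcal η hη
  have hFsub : F ⊆ Ω := by rw [hFeq]; exact union_subset hEΩ hGΩ
  rw [perimeter_eq_interaction hk hEm hΩ hEΩ, perimeter_eq_interaction hk hF hΩ hFsub]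
  change interaction (kernelDensity K) E Eᶜ + _ ≤ interaction (kernelDensity K) F Fᶜ
  calc _ = interaction (kernelDensity K) E Fᶜ +
        (interaction (kernelDensity K) G E + ENNReal.ofReal δ * volume G) := by
        rw [hEceq, interaction_union_right hk _ hFG hGm, interaction_comm hk heven E G, add_assoc]
    _ ≤ interaction (kernelDensity K) E Fᶜ + interaction (kernelDensity K) G Fᶜ := by gcongr
    _ = interaction (kernelDensity K) F Fᶜ := by
        rw [← interaction_union_left hk heven _ hEG hGm, ← hFeq]

end Minimizing

end KPer

theorem mainTheorem4 (n : ℕ) (K : EuclideanSpace ℝ (Fin n) → ℝ)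
    (hK : KPer.IsKernel K) (hT : KPer.IsTangentiallyIntegrable K) :
    (∀ E Ω : Set (EuclideanSpace ℝ (Fin n)),
      NullMeasurableSet E volume → IsOpen Ω → KPer.CompactlyIn E Ω →
      (∀ x ∈ frontier E, ∀ r : ℝ, 0 < r → 0 < volume (Metric.ball x r \ E)) →
      (KPer.IsKOutwardMinimizing K E Ω →
        ∀ x ∈ frontier E, KPer.ViscosityCurvatureGE K E x 0) ∧
      (∀ δ : ℝ, KPer.IsStronglyKOutwardMinimizing K δ E Ω →
        ∀ x ∈ frontier E, KPer.ViscosityCurvatureGE K E x δ)) ∧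
    (∀ (E : Set (EuclideanSpace ℝ (Fin n))) (δ : ℝ),
      Bornology.IsBounded E → KPer.HasC11Boundary E → KPer.IsStronglyKMeanConvex K δ E →
      ∃ Ω : Set (EuclideanSpace ℝ (Fin n)), IsOpen Ω ∧ KPer.CompactlyIn E Ω ∧
        (δ = 0 → KPer.IsKOutwardMinimizing K E Ω) ∧
        (0 < δ → KPer.IsStronglyKOutwardMinimizing K δ E Ω)) := by
  refine ⟨fun E Ω hE hΩ hEΩ hdens => ⟨fun hmin x hx => ?_, fun δ hmin x hx => ?_⟩,
    fun E δ hEb hE11 hE => ?_⟩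
  · refine KPer.viscosityCurvatureGE_of_perimeter_add_le hK hT hE hΩ hEΩ hdens le_rfl
      (fun F hF hEF hFE => ?_) hx
    rw [ENNReal.ofReal_zero, zero_mul, add_zero]
    exact hmin F hF hEF hFE
  · exact KPer.viscosityCurvatureGE_of_perimeter_add_le hK hT hE hΩ hEΩ hdens hmin.1.le hmin.2 hx
  · obtain ⟨Ω, hΩ, hEΩ, h⟩ := KPer.exists_forall_perimeter_add_le hK hT hEb hE11 hE
    refine ⟨Ω, hΩ, hEΩ, fun hδ F hF hEF hFE => ?_, fun hδ => ⟨hδ, h⟩⟩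
    have := h F hF hEF hFE
    rwa [hδ, ENNReal.ofReal_zero, zero_mul, add_zero] at this
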